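/- All graphs are finite and simple. For integers $h,k\ge 1$ let $W_{h,k}$ be the $(h,k)$-quasi-double star: the tree obtained from a path $v_1v_2v_3$ by attaching $h$ leaves to $v_1$ and $k$ leaves to $v_3$. A graph is $W_{h,k}$-free if it does not contain $W_{h,k}$ as a (not necessarily induced) subgraph. Let $\mathrm{ex}_{\mathcal P}(n,W_{h,k})$ be the maximum number of edges of a planar $W_{h,k}$-free graph on $n$ vertices. **Theorem 1.2.** Let $1\le h\le 2\le k\le 5$ and let $n\ge 0$ be an integer. (1) If $3\le h+k\le 5$, then $$\mathrm{ex}_{\mathcal P}(n,W_{h,k})\le \frac{3(h+k)}{h+k+2}\,n,$$ with equality whenever $(h+k+2)\mid n$. (2) If $h+k=6$, then $\mathrm{ex}_{\mathcal P}(n,W_{h,k})\le \frac52 n$; moreover $\mathrm{ex}_{\mathcal P}(n,W_{h,k})\ge \frac94 n$ whenever $8\mid n$, and $\mathrm{ex}_{\mathcal P}(n,W_{h,k})\ge \frac94 (n-7)$ for every $n$. If $h=1$, $k=5$ and $12\mid n$, then $\mathrm{ex}_{\mathcal P}(n,W_{1,5})=\frac52 n$. (3) $\mathrm{ex}_{\mathcal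 P}(n,W_{2,5})\le \frac{17}{6} n$; moreover $\mathrm{ex}_{\mathcal P}(n,W_{2,5})\ge \frac52 n$ whenever $12\mid n$, and $\mathrm{ex}_{\mathcal P}(n,W_{2,5})\ge \frac52 (n-11)$ for every $n$. -/

import Mathlib

namespace SimpleGraph

/-- A *rotation system* on a graph: a permutation of the darts (oriented edges) whose cycles are
exactly the sets of darts with a common origin. It prescribes the cyclic order in which the edges
leave each vertex, i.e. it is the combinatorial form of a drawing in which every component of the
graph is drawn (cellularly) on a closed oriented surface of its own. -/
structure RotationSystem {V : Type*} (G : SimpleGraph V) where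
  /-- The next dart in the cyclic order around the origin. -/
  next : Equiv.Perm G.Dart
  /-- The next dart has the same origin. -/
  next_fst : ∀ d : G.Dart, (next d).fst = d.fst
  /-- Any two darts with the same origin lie on one cycle of `next`. -/
  sameCycle_next : ∀ d d' : G.Dart, d.fst = d'.fst → next.SameCycle d d'

/-- The reversal of darts, as a permutation. -/
def dartReversal {V : Type*} (G : SimpleGraph V) : Equiv.Perm G.Dart where
  toFun := Dart.symm
  invFun := Dart.symm
  left_inv := Dart.symm_symm
  right_inv := Dart.symm_symm

/-- The face-tracing permutation: walk along a dart `u → v`, then leave `v` along the dart that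
follows `v → u` in the rotation at `v`. Its cycles are the boundary walks of the faces. -/
def RotationSystem.facePerm {V : Type*} {G : SimpleGraph V} (R : G.RotationSystem) :
    Equiv.Perm G.Dart :=
  R.next * G.dartReversal

/-- The faces of the drawing: one for each cycle of the face-tracing permutation, and one for each
isolated vertex (a single point drawn on a sphere has one face, whose boundary contains no dart). -/
def RotationSystem.Face {V : Type*} {G : SimpleGraph V} (R : G.RotationSystem) : Type _ :=
  Quotient (Equiv.Perm.SameCycle.setoid R.facePerm) ⊕ {v : V // ∀ w, ¬ G.Adj v w}

/-- A finite graph is *planar* if it has a drawing of genus zero, that is, a rotation system for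
which Euler's formula `|V| - |E| + |F| = 2 c` holds, where `c` is the number of connected
components and each component has its own outer face. (A component drawn on a surface of genus `g`
contributes `2 - 2 g` to the left side, so the formula says that every component is drawn on the
sphere.) -/
def IsPlanar {V : Type*} [Finite V] (G : SimpleGraph V) : Prop :=
  ∃ R : G.RotationSystem,
    Nat.card V + Nat.card R.Face = Nat.card G.edgeSet + 2 * Nat.card G.ConnectedComponent

open scoped Classical in
/-- The *planar Turán number* `ex_P(n, H)`: the maximum number of edges of a planar graph on `n`
vertices that does not contain `H` as a (not necessarily induced) subgraph. (The maximum is over a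
nonempty set as soon as `H` has an edge.) -/
noncomputable def planarTuranNumber (n : ℕ) {W : Type*} (H : SimpleGraph W) : ℕ :=
  Finset.sup {G : SimpleGraph (Fin n) | G.IsPlanar ∧ H.Free G} (fun G => G.edgeFinset.card)

/-- The `(h, k)`-*quasi-double star* `W_{h,k}`: a path `v₁ v₂ v₃` (the vertices `inl 0`, `inl 1`,
`inl 2`) with `h` leaves attached to `v₁` and `k` leaves attached to `v₃`. -/
def quasiDoubleStar (h k : ℕ) : SimpleGraph (Fin 3 ⊕ (Fin h ⊕ Fin k)) :=
  SimpleGraph.fromEdgeSet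
    ({s(Sum.inl 0, Sum.inl 1), s(Sum.inl 1, Sum.inl 2)} ∪
      Set.range (fun i : Fin h => s(Sum.inl 0, Sum.inr (Sum.inl i))) ∪
      Set.range (fun j : Fin k => s(Sum.inl 2, Sum.inr (Sum.inr j))))

end SimpleGraph

/-! Upper bounds come from a minimal counterexample. Write the bound as 2b·e ≤ a·n. In a smallest
vertex set violating it, every nonempty S meets more than a|S|/(2b) edges (`IsCritical`), so all
degrees exceed a/(2b) and some degree exceeds a/b. If x and z are nonadjacent with a common
neighbour and have large enough degrees, freeness gives |N(x) \ N(z)| + deg z ≤ h + k. Hence a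
vertex of degree above h + k would span, with its neighbours, a whole component, which is too
sparse; this settles h + k ≤ 4. The component of a vertex z of degree h + k is K = N(z) plus an
independent set Z. The degree sum over K and the Euler bounds for K ∪ Z and for the bipartite graph
between K and Z then contradict criticality for h + k ≥ 6, and force a K₅ for h + k = 5. For (2,5),
degree 6 is excluded by a similar count in which Z may send a few edges outside K.

Planarity enters only through the bounds 3n - 6, and 2n - 4 for bipartite subgraphs. Subgraphs are
never redrawn: in genus zero the face boundaries generate the mod 2 cycle space, so cycles with
edges in T are cuts of the dual graph, and `finrank_cuts_le` bounds their dimension.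

Lower bounds use disjoint copies of a bipyramid on h + k + 2 vertices, too small to contain the
tree, or of the icosahedron, which has no vertex of degree 6; leftover vertices stay isolated. -/

open Finset Module

namespace SimpleGraph

/-! ### The mod 2 cycle space of a drawing, and cuts of its dual graph -/

section CycleSpace

variable {V : Type*} {G : SimpleGraph V}

/-- A dart lying on a given edge. -/
noncomputable def edgeDart (e : G.edgeSet) : G.Dart :=
  (show ∃ d : G.Dart, d.edge = e from by
    obtain ⟨e, he⟩ := e
    induction e with
    | _ u v => exact ⟨⟨(u, v), he⟩, rfl⟩).choose

lemma edge_edgeDart (e : G.edgeSet) : (edgeDart e).edge = e :=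
  Exists.choose_spec (p := fun d : G.Dart => d.edge = e) _

/-- The edge of a dart, as an element of the edge set. -/
def Dart.toEdge (d : G.Dart) : G.edgeSet := ⟨d.edge, d.edge_mem⟩

@[simp] lemma Dart.toEdge_symm (d : G.Dart) : d.symm.toEdge = d.toEdge :=
  Subtype.ext d.edge_symm

lemma edgeDart_toEdge (d : G.Dart) : edgeDart d.toEdge = d ∨ edgeDart d.toEdge = d.symm :=
  (dart_edge_eq_iff _ _).1 (edge_edgeDart d.toEdge)

instance RotationSystem.finite_face [Finite V] (R : G.RotationSystem) : Finite R.Face := by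
  have : Finite G.Dart := Finite.of_injective _ Dart.toProd_injective
  unfold RotationSystem.Face
  infer_instance

/-- The face on whose boundary walk a dart lies. -/
def RotationSystem.faceOf (R : G.RotationSystem) (d : G.Dart) : R.Face :=
  Sum.inl (Quotient.mk (Equiv.Perm.SameCycle.setoid R.facePerm) d)

lemma RotationSystem.faceOf_eq_iff (R : G.RotationSystem) (d d' : G.Dart) :
    R.faceOf d = R.faceOf d' ↔ R.facePerm.SameCycle d d' := by
  constructor
  · exact fun h => Quotient.exact (Sum.inl.inj h)
  · exact fun h => congrArg Sum.inl (Quotient.sound h)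

lemma RotationSystem.faceOf_next (R : G.RotationSystem) (d : G.Dart) :
    R.faceOf (R.next d) = R.faceOf d.symm := by
  rw [faceOf_eq_iff]
  have h : R.facePerm d.symm = R.next d := by
    simp [RotationSystem.facePerm, dartReversal]
  rw [← h, Equiv.Perm.sameCycle_apply_left]

/-- The mod 2 coboundary operator of the dual graph: a set of faces is sent to the set of the edges
that lie on its boundary. -/
noncomputable def RotationSystem.dualMap (R : G.RotationSystem) :
    (R.Face → ZMod 2) →ₗ[ZMod 2] (G.edgeSet → ZMod 2) :=
  LinearMap.pi fun e =>
    LinearMap.proj (R := ZMod 2) (φ := fun _ : R.Face => ZMod 2) (R.faceOf (edgeDart e)) +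
      LinearMap.proj (R := ZMod 2) (φ := fun _ : R.Face => ZMod 2) (R.faceOf (edgeDart e).symm)

lemma RotationSystem.dualMap_apply (R : G.RotationSystem) (f : R.Face → ZMod 2) (e : G.edgeSet) :
    R.dualMap f e = f (R.faceOf (edgeDart e)) + f (R.faceOf (edgeDart e).symm) := rfl

lemma RotationSystem.dualMap_toEdge (R : G.RotationSystem) (f : R.Face → ZMod 2) (d : G.Dart) :
    R.dualMap f d.toEdge = f (R.faceOf d) + f (R.faceOf d.symm) := by
  rw [dualMap_apply]
  rcases edgeDart_toEdge d with h | h <;> rw [h]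
  rw [Dart.symm_symm, add_comm]

variable [Fintype V]

open scoped Classical in
/-- The mod 2 boundary operator of a graph. -/
noncomputable def incidenceMap (G : SimpleGraph V) :
    (G.edgeSet → ZMod 2) →ₗ[ZMod 2] (V → ZMod 2) :=
  LinearMap.pi fun v => ∑ d : G.Dart with d.fst = v, LinearMap.proj d.toEdge

open scoped Classical in
lemma incidenceMap_apply (x : G.edgeSet → ZMod 2) (v : V) :
    G.incidenceMap x v = ∑ d : G.Dart with d.fst = v, x d.toEdge := by
  simp [incidenceMap]

/-- The face across a dart is the face of the next dart at the same vertex. So the rotation permutes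
one half of the sum at a vertex onto the other, and the two cancel mod 2. -/
lemma RotationSystem.incidenceMap_dualMap (R : G.RotationSystem) (f : R.Face → ZMod 2) :
    G.incidenceMap (R.dualMap f) = 0 := by
  classical
  ext v
  rw [incidenceMap_apply, Pi.zero_apply]
  simp_rw [dualMap_toEdge, ← faceOf_next]
  rw [sum_add_distrib]
  have : ∑ d : G.Dart with d.fst = v, f (R.faceOf (R.next d)) =
      ∑ d : G.Dart with d.fst = v, f (R.faceOf d) :=
    Finset.sum_equiv R.next (by simp [R.next_fst]) (by simp)
  rw [this, CharTwo.add_self_eq_zero]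

lemma RotationSystem.range_dualMap_le (R : G.RotationSystem) :
    LinearMap.range R.dualMap ≤ LinearMap.ker G.incidenceMap := by
  rintro _ ⟨f, rfl⟩
  exact R.incidenceMap_dualMap f

open scoped Classical in
lemma incidenceMap_single (d : G.Dart) :
    G.incidenceMap (Pi.single d.toEdge 1) = Pi.single d.fst 1 + Pi.single d.snd 1 := by
  ext v
  rw [incidenceMap_apply]
  have h : ∀ d' : G.Dart, d'.toEdge = d.toEdge ↔ d' = d ∨ d' = d.symm := fun d' => by
    rw [← dart_edge_eq_iff, Dart.toEdge, Dart.toEdge, Subtype.mk.injEq]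
  have h2 : ({d' : G.Dart | d'.toEdge = d.toEdge} : Finset _) = {d, d.symm} := by
    ext d'; simp [h]
  simp only [Pi.single_apply, Pi.add_apply]
  rw [Finset.sum_filter]
  have : ∀ d' : G.Dart, (if d'.fst = v then (if d'.toEdge = d.toEdge then (1 : ZMod 2) else 0)
      else 0) = if d'.toEdge = d.toEdge then (if d'.fst = v then 1 else 0) else 0 := by
    intro d'; split_ifs <;> rfl
  simp_rw [this]
  rw [← Finset.sum_filter, h2, Finset.sum_pair (Dart.symm_ne d).symm]
  simp [eq_comm]

/-- The boundary of a path is the sum of its two ends, so modulo boundaries each vertex equals the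
representative of its component. -/
lemma card_le_finrank_range_incidenceMap (G : SimpleGraph V) :
    Nat.card V ≤ finrank (ZMod 2) (LinearMap.range G.incidenceMap) +
      Nat.card G.ConnectedComponent := by
  classical
  let r : G.ConnectedComponent → (V → ZMod 2) := fun c => Pi.single c.out 1
  have key : ∀ u v : V, G.Reachable u v →
      (Pi.single u 1 - Pi.single v 1 : V → ZMod 2) ∈ LinearMap.range G.incidenceMap := by
    rintro u v ⟨p⟩
    induction p with
    | nil => simp
    | @cons u v w h p ih =>
      have h1 : (Pi.single u 1 - Pi.single v 1 : V → ZMod 2) ∈ LinearMap.range G.incidenceMap :=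
        ⟨Pi.single (Dart.toEdge ⟨(u, v), h⟩) 1, by
          rw [incidenceMap_single]
          ext w
          simp [CharTwo.sub_eq_add]⟩
      simpa using add_mem h1 ih
  have htop : LinearMap.range G.incidenceMap ⊔ Submodule.span (ZMod 2) (Set.range r) = ⊤ := by
    rw [eq_top_iff, ← (Pi.basisFun (ZMod 2) V).span_eq, Submodule.span_le]
    rintro _ ⟨v, rfl⟩
    have h1 : G.Reachable v (G.connectedComponentMk v).out :=
      (ConnectedComponent.exact (Quot.out_eq (G.connectedComponentMk v))).symm
    have h2 := Submodule.add_mem_sup (key _ _ h1)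
      (Submodule.subset_span (R := ZMod 2) (Set.mem_range_self (f := r) (G.connectedComponentMk v)))
    simpa [r] using h2
  have h1 := Submodule.finrank_add_le_finrank_add_finrank (LinearMap.range G.incidenceMap)
    (Submodule.span (ZMod 2) (Set.range r))
  rw [htop, finrank_top, finrank_pi] at h1
  have h2 : finrank (ZMod 2) (Submodule.span (ZMod 2) (Set.range r)) ≤ _ :=
    finrank_range_le_card (R := ZMod 2) r
  rw [Nat.card_eq_fintype_card, Nat.card_eq_fintype_card]
  omega

/-- The face of an isolated vertex. -/
def RotationSystem.isolatedFace (R : G.RotationSystem) (v : V) (hv : ∀ w, ¬ G.Adj v w) : R.Face :=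
  Sum.inr ⟨v, hv⟩

open scoped Classical in
/-- A face at a given vertex. -/
noncomputable def RotationSystem.faceAt (R : G.RotationSystem) (v : V) : R.Face :=
  if h : ∃ d : G.Dart, d.fst = v then R.faceOf h.choose
  else R.isolatedFace v fun w hw => h ⟨⟨(v, w), hw⟩, rfl⟩

lemma RotationSystem.apply_faceOf_eq (R : G.RotationSystem) {f : R.Face → ZMod 2}
    (hf : R.dualMap f = 0) {d d' : G.Dart} (h : d.fst = d'.fst) :
    f (R.faceOf d) = f (R.faceOf d') := by
  have hsymm : ∀ d, f (R.faceOf d.symm) = f (R.faceOf d) := fun d => by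
    have := congrFun hf d.toEdge
    rw [dualMap_toEdge, Pi.zero_apply, CharTwo.add_eq_zero] at this
    exact this.symm
  have hnext : ∀ d, f (R.faceOf (R.next d)) = f (R.faceOf d) := fun d => by
    rw [faceOf_next, hsymm]
  classical
  obtain ⟨n, rfl⟩ := (R.sameCycle_next d d' h).exists_nat_pow_eq
  clear h
  induction n with
  | zero => rfl
  | succ n ih => rw [pow_succ', Equiv.Perm.mul_apply, hnext, ← ih]

lemma RotationSystem.apply_faceAt_fst (R : G.RotationSystem) {f : R.Face → ZMod 2}
    (hf : R.dualMap f = 0) (d : G.Dart) : f (R.faceAt d.fst) = f (R.faceOf d) := by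
  have h : ∃ d' : G.Dart, d'.fst = d.fst := ⟨d, rfl⟩
  rw [faceAt, dif_pos h]
  exact R.apply_faceOf_eq hf h.choose_spec

lemma RotationSystem.apply_faceAt_eq (R : G.RotationSystem) {f : R.Face → ZMod 2}
    (hf : R.dualMap f = 0) {u v : V} (h : G.Reachable u v) :
    f (R.faceAt u) = f (R.faceAt v) := by
  obtain ⟨p⟩ := h
  induction p with
  | nil => rfl
  | @cons u v w h p ih =>
    rw [← ih, R.apply_faceAt_fst hf ⟨(u, v), h⟩]
    have := R.apply_faceAt_fst hf (Dart.symm ⟨(u, v), h⟩)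
    have h2 := congrFun hf (Dart.toEdge ⟨(u, v), h⟩)
    rw [dualMap_toEdge, Pi.zero_apply, CharTwo.add_eq_zero] at h2
    rw [h2, ← this]
    rfl

/-- A function on faces killed by `dualMap` agrees across every edge, hence around each vertex and
along each path: one value per component determines it. -/
lemma RotationSystem.card_face_le (R : G.RotationSystem) :
    Nat.card R.Face ≤ finrank (ZMod 2) (LinearMap.range R.dualMap) +
      Nat.card G.ConnectedComponent := by
  classical
  have := Fintype.ofFinite R.Face
  have h0 := R.dualMap.finrank_range_add_finrank_ker
  rw [finrank_pi] at h0
  let L : (R.Face → ZMod 2) →ₗ[ZMod 2] (G.ConnectedComponent → ZMod 2) :=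
    LinearMap.pi fun c => LinearMap.proj (R.faceAt c.out)
  have hL : ∀ f c, L f c = f (R.faceAt c.out) := fun _ _ => rfl
  have hinj : Function.Injective (L.domRestrict (LinearMap.ker R.dualMap)) := by
    rw [injective_iff_map_eq_zero]
    rintro ⟨f, hf⟩ h
    rw [LinearMap.mem_ker] at hf
    have h1 : ∀ v, f (R.faceAt v) = 0 := fun v => by
      have h2 := congrFun h (G.connectedComponentMk v)
      rw [LinearMap.domRestrict_apply, hL, Pi.zero_apply] at h2
      rw [← h2]
      exact R.apply_faceAt_eq hf
        (ConnectedComponent.exact (Quot.out_eq (G.connectedComponentMk v))).symm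
    rw [Submodule.mk_eq_zero]
    ext F
    rcases F with q | ⟨v, hv⟩
    · induction q using Quotient.inductionOn with
      | h d => exact (R.apply_faceAt_fst hf d).symm.trans (h1 _)
    · have h3 := h1 v
      rw [faceAt, dif_neg] at h3
      · exact h3
      · rintro ⟨d, rfl⟩
        exact hv _ d.adj
  have h1 := LinearMap.finrank_le_finrank_of_injective hinj
  rw [finrank_pi] at h1
  rw [Nat.card_eq_fintype_card, Nat.card_eq_fintype_card]
  omega

lemma finrank_ker_incidenceMap_le (G : SimpleGraph V) :
    finrank (ZMod 2) (LinearMap.ker G.incidenceMap) + Nat.card V ≤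
      Nat.card G.edgeSet + Nat.card G.ConnectedComponent := by
  classical
  have h0 := G.incidenceMap.finrank_range_add_finrank_ker
  rw [finrank_pi, ← Nat.card_eq_fintype_card] at h0
  have := G.card_le_finrank_range_incidenceMap
  omega

/-- The genus of a rotation system is nonnegative. -/
theorem RotationSystem.card_add_card_face_le (R : G.RotationSystem) :
    Nat.card V + Nat.card R.Face ≤ Nat.card G.edgeSet + 2 * Nat.card G.ConnectedComponent := by
  have h1 := R.card_face_le
  have h2 := Submodule.finrank_mono R.range_dualMap_le
  have h3 := G.finrank_ker_incidenceMap_le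
  omega

/-- In a plane drawing the boundaries of the faces generate the cycle space. -/
theorem RotationSystem.range_dualMap (R : G.RotationSystem)
    (hR : Nat.card V + Nat.card R.Face = Nat.card G.edgeSet + 2 * Nat.card G.ConnectedComponent) :
    LinearMap.range R.dualMap = LinearMap.ker G.incidenceMap := by
  have h1 := R.card_face_le
  have h3 := G.finrank_ker_incidenceMap_le
  -- Genus zero leaves no slack in |F| - c ≤ dim range ≤ dim ker ≤ |E| - |V| + c.
  exact Submodule.eq_of_le_of_finrank_le R.range_dualMap_le (by omega)

end CycleSpace

end SimpleGraph

/-- Let `E` be the edges of a graph with vertex set `F`, given by their two ends `l` and `r`, and let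
`U` be the space of the edge cuts that lie inside `T`. If every nonempty cut in `U` has at least `m`
elements, then the dimension of `U` is at most `2 |T| / m - 1`, or `0`. -/
lemma finrank_cuts_le {E F : Type*} [Fintype E] [Finite F] [DecidableEq E] (l r : E → F)
    (T : Finset E) (U : Submodule (ZMod 2) (E → ZMod 2)) (m : ℕ)
    (hU : ∀ x ∈ U, ∀ e ∉ T, x e = 0)
    (hrep : ∀ x ∈ U, ∃ q : F → ZMod 2, ∀ e, x e = q (l e) + q (r e))
    (hmem : ∀ q : F → ZMod 2, (∀ e ∉ T, q (l e) = q (r e)) → (fun e => q (l e) + q (r e)) ∈ U)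
    (hsupp : ∀ x ∈ U, x ≠ 0 → m ≤ #{e | x e ≠ 0}) :
    finrank (ZMod 2) U = 0 ∨ m * (finrank (ZMod 2) U + 1) ≤ 2 * #T := by
  classical
  -- Contract the edges outside `T`: the cuts inside `T` are the cuts of the contracted graph, and
  -- `w c` below is the star of its vertex `c`, loops cancelling mod 2.
  let rel : F → F → Prop := fun a b => ∃ e ∉ T, a = l e ∧ b = r e
  have := Fintype.ofFinite (Quot rel)
  let w : Quot rel → E → ZMod 2 := fun c e =>
    (if Quot.mk rel (l e) = c then 1 else 0) + (if Quot.mk rel (r e) = c then 1 else 0)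
  have hmk : ∀ e ∉ T, Quot.mk rel (l e) = Quot.mk rel (r e) := fun e he =>
    Quot.sound ⟨e, he, rfl, rfl⟩
  have hw : ∀ c, w c ∈ U := fun c =>
    hmem (fun a => if Quot.mk rel a = c then 1 else 0) fun e he => by simp only [hmk e he]
  have hsum : ∑ c, w c = 0 := by
    ext e
    simp [w, Finset.sum_apply, sum_add_distrib, CharTwo.add_self_eq_zero]
  let N : Finset (Quot rel) := {c | w c ≠ 0}
  have hx : ∀ x ∈ U, ∃ q : Quot rel → ZMod 2, x = ∑ c, q c • w c := by
    intro x hx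
    obtain ⟨q, hq⟩ := hrep x hx
    refine ⟨Quot.lift q ?_, ?_⟩
    · rintro _ _ ⟨e, he, rfl, rfl⟩
      have := hq e
      rw [hU x hx e he, eq_comm, CharTwo.add_eq_zero] at this
      exact this
    · ext e
      simp [w, Finset.sum_apply, mul_add, sum_add_distrib, hq]
  rcases N.eq_empty_or_nonempty with hN | ⟨c₀, hc₀⟩
  · left
    have : U = ⊥ := by
      rw [eq_bot_iff]
      intro x hxU
      obtain ⟨q, rfl⟩ := hx x hxU
      refine sum_eq_zero fun c _ => ?_
      have : c ∉ N := by simp [hN]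
      have : w c = 0 := by simpa [N] using this
      rw [this, smul_zero]
    rw [this, finrank_bot]
  · right
    -- All stars sum to zero, so one nonzero star is redundant; this is the source of the `+ 1`.
    have hle : U ≤ Submodule.span (ZMod 2) ((N.erase c₀).image w : Finset (E → ZMod 2)) := by
      intro x hxU
      obtain ⟨q, rfl⟩ := hx x hxU
      have : ∑ c, q c • w c = ∑ c, (q c - q c₀) • w c := by
        simp_rw [sub_smul, sum_sub_distrib, ← smul_sum, hsum, smul_zero, sub_zero]
      rw [this]
      refine Submodule.sum_mem _ fun c _ => ?_
      by_cases hc : c ∈ N.erase c₀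
      · exact Submodule.smul_mem _ _ (Submodule.subset_span (by
          exact mem_coe.2 (mem_image_of_mem w hc)))
      · have : (q c - q c₀) • w c = 0 := by
          rw [mem_erase, not_and_or, not_not] at hc
          rcases hc with rfl | hc
          · simp
          · have : w c = 0 := by simpa [N] using hc
            rw [this, smul_zero]
        rw [this]
        exact zero_mem _
    have h1 : finrank (ZMod 2) U + 1 ≤ #N := by
      have h2 := (Submodule.finrank_mono hle).trans (finrank_span_finset_le_card _)
      have h3 : #((N.erase c₀).image w) ≤ #(N.erase c₀) := card_image_le
      rw [card_erase_of_mem hc₀] at h3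
      have : 0 < #N := card_pos.2 ⟨c₀, hc₀⟩
      omega
    refine (Nat.mul_le_mul_left m h1).trans ?_
    -- Double counting: an edge of `T` lies in at most two stars.
    calc m * #N = ∑ c ∈ N, m := by rw [sum_const, smul_eq_mul, mul_comm]
      _ ≤ ∑ c ∈ N, #{e | w c e ≠ 0} := sum_le_sum fun c hc =>
          hsupp _ (hw c) (by simpa [N] using hc)
      _ = ∑ e, #{c ∈ N | w c e ≠ 0} := by simp_rw [card_filter]; exact sum_comm
      _ = ∑ e ∈ T, #{c ∈ N | w c e ≠ 0} := by
          refine (sum_subset (subset_univ T) fun e _ he => ?_).symm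
          rw [card_eq_zero, filter_eq_empty_iff]
          exact fun c _ => not_not.2 (hU _ (hw c) e he)
      _ ≤ ∑ e ∈ T, 2 := sum_le_sum fun e _ => by
          refine (card_le_card (t := {Quot.mk rel (l e), Quot.mk rel (r e)}) ?_).trans card_le_two
          intro c hc
          by_contra h
          simp only [mem_insert, mem_singleton, not_or] at h
          simp [w, Ne.symm h.1, Ne.symm h.2] at hc
      _ = 2 * #T := by rw [sum_const, smul_eq_mul, mul_comm]

namespace SimpleGraph

/-! ### Euler bounds for the subgraphs of a planar graph -/

section Sparse

variable {V : Type*} {G : SimpleGraph V}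

open scoped Classical in
/-- The number of ordered pairs in `S × T` that are adjacent. -/
noncomputable def adjCount (G : SimpleGraph V) (S T : Finset V) : ℕ :=
  ∑ u ∈ S, ∑ v ∈ T, if G.Adj u v then 1 else 0

open scoped Classical in
lemma adjCount_eq_card (S T : Finset V) :
    G.adjCount S T = #{p ∈ S ×ˢ T | G.Adj p.1 p.2} := by
  rw [adjCount, card_filter, sum_product]

variable [Fintype V]

/-- The mod 2 cycles of a graph that use edges in `T` only. -/
noncomputable def cyclesIn (G : SimpleGraph V) (T : Finset G.edgeSet) :
    Submodule (ZMod 2) (G.edgeSet → ZMod 2) :=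
  LinearMap.ker G.incidenceMap ⊓ ⨅ e ∉ T, LinearMap.ker (LinearMap.proj e)

lemma mem_cyclesIn {T : Finset G.edgeSet} {x : G.edgeSet → ZMod 2} :
    x ∈ G.cyclesIn T ↔ G.incidenceMap x = 0 ∧ ∀ e ∉ T, x e = 0 := by
  simp [cyclesIn]

lemma sum_incidenceMap (x : G.edgeSet → ZMod 2) : ∑ v, G.incidenceMap x v = 0 := by
  classical
  simp_rw [incidenceMap_apply]
  rw [Finset.sum_fiberwise univ (fun d : G.Dart => d.fst) (fun d => x d.toEdge)]
  refine Finset.sum_involution (fun d _ => d.symm) (fun d _ => ?_) (fun d _ _ => d.symm_ne)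
    (fun d _ => mem_univ _) (fun d _ => d.symm_symm)
  rw [Dart.toEdge_symm, CharTwo.add_self_eq_zero]

/-- These cycles are cut out by vanishing off `T` and by the boundary conditions on `S`. The
boundary always sums to zero, so the condition at one vertex of `S` can be dropped. -/
lemma card_le_finrank_cyclesIn (T : Finset G.edgeSet) (S : Finset V) (hS : S.Nonempty)
    (hT : ∀ d : G.Dart, d.toEdge ∈ T → d.fst ∈ S) :
    #T + 1 ≤ finrank (ZMod 2) (G.cyclesIn T) + #S := by
  classical
  obtain ⟨s, hs⟩ := hS
  let M : (G.edgeSet → ZMod 2) →ₗ[ZMod 2]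
      ({e // e ∉ T} → ZMod 2) × ({v // v ∈ S.erase s} → ZMod 2) :=
    (LinearMap.funLeft (ZMod 2) (ZMod 2) Subtype.val).prod
      ((LinearMap.funLeft (ZMod 2) (ZMod 2) Subtype.val).comp G.incidenceMap)
  have hker : LinearMap.ker M ≤ G.cyclesIn T := by
    intro x hx
    rw [LinearMap.mem_ker, LinearMap.prod_apply, Prod.ext_iff] at hx
    have h1 : ∀ e ∉ T, x e = 0 := fun e he => congrFun hx.1 ⟨e, he⟩
    have h2 : ∀ v ∈ S.erase s, G.incidenceMap x v = 0 := fun v hv => congrFun hx.2 ⟨v, hv⟩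
    have h3 : ∀ v, v ≠ s → G.incidenceMap x v = 0 := fun v hv => by
      by_cases h : v ∈ S
      · exact h2 v (mem_erase.2 ⟨hv, h⟩)
      · rw [incidenceMap_apply]
        refine sum_eq_zero fun d hd => h1 _ fun hd' => h ?_
        rw [← (mem_filter.1 hd).2]
        exact hT d hd'
    refine mem_cyclesIn.2 ⟨funext fun v => ?_, h1⟩
    by_cases hv : v = s
    · subst hv
      have := sum_incidenceMap x
      rwa [Finset.sum_eq_single v (fun u _ hu => h3 u hu) (by simp)] at this
    · exact h3 v hv
  have h1 := M.finrank_range_add_finrank_ker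
  have h2 := Submodule.finrank_le (LinearMap.range M)
  have h3 := Submodule.finrank_mono hker
  rw [finrank_prod, finrank_pi, finrank_pi, Fintype.card_coe, card_erase_of_mem hs,
    Fintype.card_subtype_compl, Fintype.card_coe] at h2
  rw [finrank_pi] at h1
  have h4 : #T ≤ Fintype.card G.edgeSet := card_le_univ T
  have h5 : 0 < #S := card_pos.2 ⟨s, hs⟩
  omega

lemma exists_ne_of_incidenceMap_eq_zero {x : G.edgeSet → ZMod 2} (hx : G.incidenceMap x = 0)
    {u v : V} (h : G.Adj u v) (hxe : x ⟨s(u, v), h⟩ ≠ 0) :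
    ∃ w, ∃ h' : G.Adj u w, w ≠ v ∧ x ⟨s(u, w), h'⟩ ≠ 0 := by
  classical
  by_contra! hcon
  have h1 := congrFun hx u
  rw [incidenceMap_apply, Pi.zero_apply, Finset.sum_eq_single (⟨(u, v), h⟩ : G.Dart)] at h1
  · exact hxe h1
  · rintro ⟨⟨a, b⟩, hab⟩ hd hne
    obtain rfl : a = u := (mem_filter.1 hd).2
    exact hcon b hab fun hb => hne (by subst hb; rfl)
  · simp

open scoped Classical in
-- The support continues past both ends of each of its edges. This gives support edges tu, uv, vw,
-- which form a triangle if t = w and otherwise continue past w with a fourth edge.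
lemma three_le_card_support {x : G.edgeSet → ZMod 2} (hx : G.incidenceMap x = 0) (hx0 : x ≠ 0) :
    3 ≤ #{e | x e ≠ 0} ∧ (4 ≤ #{e | x e ≠ 0} ∨ ∃ u v w,
      ∃ (huv : G.Adj u v) (hvw : G.Adj v w) (huw : G.Adj u w),
        x ⟨s(u, v), huv⟩ ≠ 0 ∧ x ⟨s(v, w), hvw⟩ ≠ 0 ∧ x ⟨s(u, w), huw⟩ ≠ 0) := by
  classical
  obtain ⟨⟨e, he⟩, hxe⟩ := Function.ne_iff.1 hx0
  induction e with
  | _ u v =>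
  have huv : G.Adj u v := he
  have hxe' : x ⟨s(v, u), huv.symm⟩ ≠ 0 := by
    have : (⟨s(v, u), huv.symm⟩ : G.edgeSet) = ⟨s(u, v), he⟩ := Subtype.ext Sym2.eq_swap
    rwa [this]
  obtain ⟨t, hut, htv, hxt⟩ := exists_ne_of_incidenceMap_eq_zero hx huv hxe
  obtain ⟨w, hvw, hwu, hxw⟩ := exists_ne_of_incidenceMap_eq_zero hx huv.symm hxe'
  have hne := huv.ne
  have hne' := hut.ne
  have hne'' := hvw.ne
  constructor
  · have : ({⟨s(u, v), he⟩, ⟨s(u, t), hut⟩, ⟨s(v, w), hvw⟩} : Finset G.edgeSet) ⊆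
        ({e | x e ≠ 0} : Finset _) := by
      intro e he
      simp only [mem_insert, mem_singleton] at he
      rcases he with rfl | rfl | rfl <;> simpa
    refine le_trans (le_of_eq ?_) (card_le_card this)
    rw [card_insert_of_notMem, card_pair]
    · grind
    · grind
  · by_cases htw : t = w
    · subst htw
      exact Or.inr ⟨u, v, t, huv, hvw, hut, hxe, hxw, hxt⟩
    left
    have hxw' : x ⟨s(w, v), hvw.symm⟩ ≠ 0 := by
      have : (⟨s(w, v), hvw.symm⟩ : G.edgeSet) = ⟨s(v, w), hvw⟩ := Subtype.ext Sym2.eq_swap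
      rwa [this]
    obtain ⟨z, hwz, hzv, hxz⟩ := exists_ne_of_incidenceMap_eq_zero hx hvw.symm hxw'
    have : ({⟨s(u, v), he⟩, ⟨s(u, t), hut⟩, ⟨s(v, w), hvw⟩, ⟨s(w, z), hwz⟩} : Finset G.edgeSet) ⊆
        ({e | x e ≠ 0} : Finset _) := by
      intro e he
      simp only [mem_insert, mem_singleton] at he
      rcases he with rfl | rfl | rfl | rfl <;> simpa
    refine le_trans (le_of_eq ?_) (card_le_card this)
    have := hwz.ne
    rw [card_insert_of_notMem, card_insert_of_notMem, card_pair]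
    · grind
    · grind
    · grind

open scoped Classical in
/-- A set of edges of a planar graph, all of whose nonempty cycles have length at least `m`, is
either a forest or satisfies the bound given by Euler's formula. -/
lemma IsPlanar.card_edges_le (hG : G.IsPlanar) (T : Finset G.edgeSet) (S : Finset V)
    (hS : S.Nonempty) (hT : ∀ d : G.Dart, d.toEdge ∈ T → d.fst ∈ S) (m : ℕ)
    (hm : ∀ x ∈ G.cyclesIn T, x ≠ 0 → m ≤ #{e | x e ≠ 0}) :
    #T + 1 ≤ #S ∨ m * (#T + 2) ≤ 2 * #T + m * #S := by
  classical
  obtain ⟨R, hR⟩ := hG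
  have h := card_le_finrank_cyclesIn T S hS hT
  have hrange := R.range_dualMap hR
  have hrep : ∀ x ∈ G.cyclesIn T, ∃ q : R.Face → ZMod 2,
      ∀ e, x e = q (R.faceOf (edgeDart e)) + q (R.faceOf (edgeDart e).symm) := by
    intro x hx
    have h2 : x ∈ LinearMap.range R.dualMap := by
      rw [hrange]; exact (mem_cyclesIn.1 hx).1
    obtain ⟨q, rfl⟩ := h2
    exact ⟨q, fun e => R.dualMap_apply q e⟩
  -- In the dual graph an edge joins the faces of its two darts.
  rcases finrank_cuts_le _ _ T (G.cyclesIn T) m (fun x hx => (mem_cyclesIn.1 hx).2) hrep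
    (fun q hq => mem_cyclesIn.2 ⟨R.incidenceMap_dualMap q, fun e he => by
      rw [hq e he, CharTwo.add_self_eq_zero]⟩) hm with h1 | h1
  · omega
  · have : m * (#T + 2) ≤ m * (finrank (ZMod 2) (G.cyclesIn T) + 1) + m * #S := by
      rw [← mul_add]
      exact Nat.mul_le_mul_left m (by omega)
    omega

open scoped Classical in
/-- The edges with one end in `S` and one end in `T`. -/
noncomputable def edgesBetween (G : SimpleGraph V) (S T : Finset V) : Finset G.edgeSet :=
  {e | ∃ u ∈ S, ∃ v ∈ T, e.1 = s(u, v)}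

lemma mem_edgesBetween {S T : Finset V} {u v : V} {h : s(u, v) ∈ G.edgeSet} :
    ⟨s(u, v), h⟩ ∈ G.edgesBetween S T ↔ u ∈ S ∧ v ∈ T ∨ v ∈ S ∧ u ∈ T := by
  simp only [edgesBetween, mem_filter, mem_univ, true_and, Sym2.eq_iff]
  grind

lemma adjCount_le_card_edgesBetween {S T : Finset V} (h : Disjoint S T) :
    G.adjCount S T ≤ #(G.edgesBetween S T) := by
  classical
  rw [adjCount_eq_card, ← card_attach]
  refine card_le_card_of_injOn
    (fun p => ⟨s(p.1.1, p.1.2), (mem_filter.1 p.2).2⟩) (fun p _ => ?_) ?_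
  · have := mem_product.1 (mem_filter.1 p.2).1
    exact mem_edgesBetween.2 (Or.inl this)
  · rintro ⟨⟨a, b⟩, hp⟩ - ⟨⟨c, d⟩, hq⟩ - hpq
    have h1 := mem_product.1 (mem_filter.1 hp).1
    have h2 := mem_product.1 (mem_filter.1 hq).1
    replace hpq := Sym2.eq_iff.1 (congrArg Subtype.val hpq)
    simp only [Subtype.mk.injEq, Prod.mk.injEq]
    rcases hpq with hpq | hpq
    · exact hpq
    · exact absurd h2.2 (Finset.disjoint_left.1 h (hpq.1 ▸ h1.1))

lemma adjCount_self_le_card_edgesBetween (S : Finset V) :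
    G.adjCount S S ≤ 2 * #(G.edgesBetween S S) := by
  classical
  rw [adjCount_eq_card, ← card_attach]
  refine card_le_mul_card_image_of_maps_to
    (f := fun p => ⟨s(p.1.1, p.1.2), (mem_filter.1 p.2).2⟩) (fun p _ => ?_) 2 ?_
  · have := mem_product.1 (mem_filter.1 p.2).1
    exact mem_edgesBetween.2 (Or.inl this)
  · rintro ⟨e, he⟩ -
    induction e with
    | _ u v =>
    refine le_trans ?_ (card_le_two (a := (u, v)) (b := (v, u)))
    refine card_le_card_of_injOn (fun p => p.1) ?_ Subtype.val_injective.injOn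
    rintro ⟨⟨a, b⟩, hp⟩ hq
    replace hq := Sym2.eq_iff.1 (congrArg Subtype.val (mem_filter.1 hq).2)
    simpa using hq

theorem IsPlanar.adjCount_self_le (hG : G.IsPlanar) (S : Finset V) (hS : 3 ≤ #S) :
    G.adjCount S S + 12 ≤ 6 * #S := by
  have h1 := hG.card_edges_le (G.edgesBetween S S) S (card_pos.1 (by omega)) ?_ 3
    (fun x hx h0 => (three_le_card_support (mem_cyclesIn.1 hx).1 h0).1)
  · have := G.adjCount_self_le_card_edgesBetween S
    omega
  · rintro ⟨⟨u, v⟩, h⟩ hd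
    have := mem_edgesBetween.1 hd
    tauto

theorem IsPlanar.adjCount_le_of_disjoint (hG : G.IsPlanar) {S T : Finset V} (hST : Disjoint S T)
    (h3 : 3 ≤ #S + #T) : G.adjCount S T + 4 ≤ 2 * (#S + #T) := by
  classical
  have hcard := card_union_of_disjoint hST
  have h1 := hG.card_edges_le (G.edgesBetween S T) (S ∪ T) (card_pos.1 (by omega)) ?_ 4 ?_
  · have := G.adjCount_le_card_edgesBetween hST
    omega
  · rintro ⟨⟨u, v⟩, h⟩ hd
    have := mem_edgesBetween.1 hd
    rw [mem_union]
    tauto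
  · intro x hx h0
    -- No triangle has all its edges between two disjoint sets.
    refine (three_le_card_support (mem_cyclesIn.1 hx).1 h0).2.resolve_right ?_
    rintro ⟨u, v, w, huv, hvw, huw, h1, h2, h3⟩
    have hT := (mem_cyclesIn.1 hx).2
    have h1 := mem_edgesBetween.1 (not_imp_comm.1 (hT _) h1)
    have h2 := mem_edgesBetween.1 (not_imp_comm.1 (hT _) h2)
    have h3 := mem_edgesBetween.1 (not_imp_comm.1 (hT _) h3)
    have hd := Finset.disjoint_left.1 hST
    grind

end Sparse

end SimpleGraph

/-! ### Finding a quasi-double star -/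

lemma Finset.exists_disjoint_subsets {α : Type*} [DecidableEq α] {A B : Finset α} {h k : ℕ}
    (hA : h ≤ #A) (hB : k ≤ #B) (hAB : h + k ≤ #(A ∪ B)) :
    ∃ A' ⊆ A, ∃ B' ⊆ B, Disjoint A' B' ∧ #A' = h ∧ #B' = k := by
  rcases le_total h #(A \ B) with h1 | h1
  · obtain ⟨A', hA', hcA⟩ := exists_subset_card_eq h1
    obtain ⟨B', hB', hcB⟩ := exists_subset_card_eq hB
    exact ⟨A', hA'.trans sdiff_subset, B', hB',
      disjoint_of_subset_left hA' (disjoint_of_subset_right hB' sdiff_disjoint), hcA, hcB⟩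
  -- Here `A'` contains all of `A \ B`, so `A ∪ B` splits into `A'` and `B \ A'`, and the latter
  -- keeps at least `k` elements.
  · obtain ⟨A', hA1, hA2, hcA⟩ := exists_subsuperset_card_eq sdiff_subset h1 hA
    have h2 : A ∪ B = A' ∪ (B \ A') := by
      ext x
      have := @hA1 x
      have := @hA2 x
      simp only [mem_union, mem_sdiff] at *
      tauto
    have h3 : k ≤ #(B \ A') := by
      rw [h2, card_union_of_disjoint disjoint_sdiff] at hAB
      omega
    obtain ⟨B', hB', hcB⟩ := exists_subset_card_eq h3
    exact ⟨A', hA2, B', hB'.trans sdiff_subset,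
      disjoint_of_subset_right hB' disjoint_sdiff, hcA, hcB⟩

namespace SimpleGraph

lemma quasiDoubleStar_adj_of_forall {h k : ℕ} {V : Type*} {G : SimpleGraph V}
    (f : Fin 3 ⊕ (Fin h ⊕ Fin k) → V)
    (h01 : G.Adj (f (.inl 0)) (f (.inl 1))) (h12 : G.Adj (f (.inl 1)) (f (.inl 2)))
    (h0 : ∀ i, G.Adj (f (.inl 0)) (f (.inr (.inl i))))
    (h2 : ∀ j, G.Adj (f (.inl 2)) (f (.inr (.inr j)))) {p q : Fin 3 ⊕ (Fin h ⊕ Fin k)}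
    (hpq : (quasiDoubleStar h k).Adj p q) : G.Adj (f p) (f q) := by
  rw [quasiDoubleStar, fromEdgeSet_adj] at hpq
  rcases hpq with ⟨((e | e) | ⟨i, e⟩) | ⟨j, e⟩, -⟩ <;>
    rcases Sym2.eq_iff.1 e with ⟨rfl, rfl⟩ | ⟨rfl, rfl⟩
  exacts [h01, h01.symm, h12, h12.symm, h0 i, (h0 i).symm, h2 j, (h2 j).symm]

lemma quasiDoubleStar_isContained {h k : ℕ} {V : Type*} [DecidableEq V] {G : SimpleGraph V}
    {x y z : V} (hxy : G.Adj x y) (hyz : G.Adj y z) (hxz : x ≠ z) {A B : Finset V}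
    (hA : ∀ v ∈ A, G.Adj x v ∧ v ≠ y ∧ v ≠ z) (hB : ∀ v ∈ B, G.Adj z v ∧ v ≠ x ∧ v ≠ y)
    (hcA : h ≤ #A) (hcB : k ≤ #B) (hAB : h + k ≤ #(A ∪ B)) : quasiDoubleStar h k ⊑ G := by
  obtain ⟨A', hA', B', hB', hd, hcA, hcB⟩ := exists_disjoint_subsets hcA hcB hAB
  let a := (A'.equivFinOfCardEq hcA).symm
  let b := (B'.equivFinOfCardEq hcB).symm
  have ha := fun i => hA _ (hA' (a i).2)
  have hb := fun j => hB _ (hB' (b j).2)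
  let f : Fin 3 ⊕ (Fin h ⊕ Fin k) → V :=
    Sum.elim ![x, y, z] (Sum.elim (fun i => (a i : V)) fun j => (b j : V))
  refine ⟨⟨⟨f, fun hpq => quasiDoubleStar_adj_of_forall f hxy hyz (fun i => (ha i).1)
    (fun j => (hb j).1) hpq⟩, ?_⟩⟩
  have hxy' := hxy.ne
  have hyz' := hyz.ne
  refine Function.Injective.sumElim ?_ (Function.Injective.sumElim
    (Subtype.val_injective.comp a.injective) (Subtype.val_injective.comp b.injective) ?_) ?_
  · intro i j hij
    fin_cases i <;> fin_cases j <;> simp_all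
  · intro i j hij
    exact Finset.disjoint_left.1 hd (a i).2 (hij ▸ (b j).2)
  · rintro i (j | j) hij
    · have h1 := ha j
      have h2 := h1.1.ne
      fin_cases i <;> simp_all
    · have h1 := hb j
      have h2 := h1.1.ne
      fin_cases i <;> simp_all

section AdjCount

variable {V : Type*} {G : SimpleGraph V}

lemma adjCount_comm (S T : Finset V) : G.adjCount S T = G.adjCount T S := by
  classical
  rw [adjCount, sum_comm, adjCount]
  exact sum_congr rfl fun u _ => sum_congr rfl fun v _ => if_congr (G.adj_comm v u) rfl rfl

lemma adjCount_union_left [DecidableEq V] {S S' : Finset V} (h : Disjoint S S') (T : Finset V) :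
    G.adjCount (S ∪ S') T = G.adjCount S T + G.adjCount S' T :=
  sum_union h

lemma adjCount_union_right [DecidableEq V] (S : Finset V) {T T' : Finset V} (h : Disjoint T T') :
    G.adjCount S (T ∪ T') = G.adjCount S T + G.adjCount S T' := by
  rw [adjCount_comm, adjCount_union_left h, adjCount_comm T, adjCount_comm T']

lemma adjCount_eq_zero {S T : Finset V} (h : ∀ u ∈ S, ∀ v ∈ T, ¬ G.Adj u v) :
    G.adjCount S T = 0 :=
  sum_eq_zero fun u hu => sum_eq_zero fun v hv => if_neg (h u hu v hv)

lemma even_adjCount_self (S : Finset V) : Even (G.adjCount S S) := by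
  classical
  rw [even_iff_two_dvd, ← ZMod.natCast_eq_zero_iff, adjCount_eq_card, card_eq_sum_ones,
    Nat.cast_sum]
  refine sum_involution (fun p _ => p.swap) (fun p _ => by decide) (fun p hp _ h => ?_)
    (fun p hp => ?_) (fun p _ => p.swap_swap)
  · have h1 := (mem_filter.1 hp).2.ne
    exact h1 (congrArg Prod.snd h)
  · simp only [mem_filter, mem_product] at hp ⊢
    exact ⟨hp.1.symm, hp.2.symm⟩

lemma adjCount_mono_graph {H : SimpleGraph V} (h : H ≤ G) (S T : Finset V) :
    H.adjCount S T ≤ G.adjCount S T :=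
  sum_le_sum fun u _ => sum_le_sum fun v _ => by
    split_ifs with h1 h2
    exacts [le_rfl, absurd (h h1) h2, zero_le_one, le_rfl]

variable [Fintype V]

open scoped Classical in
lemma adjCount_eq_sum (S T : Finset V) :
    G.adjCount S T = ∑ u ∈ S, #(G.neighborFinset u ∩ T) := by
  refine sum_congr rfl fun u _ => ?_
  rw [← card_filter]
  congr 1
  ext v
  simp [and_comm]

open scoped Classical in
lemma adjCount_eq_sum_degree {S T : Finset V} (h : ∀ u ∈ S, ∀ v, G.Adj u v → v ∈ T) :
    G.adjCount S T = ∑ u ∈ S, G.degree u := by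
  rw [adjCount_eq_sum]
  refine sum_congr rfl fun u hu => ?_
  rw [inter_eq_left.2, card_neighborFinset_eq_degree]
  intro v hv
  exact h u hu v ((mem_neighborFinset ..).1 hv)

end AdjCount

/-! ### Structure of minimal counterexamples -/

section Critical

variable {V : Type*} [Fintype V] {G : SimpleGraph V} {A : Finset V} {h k a b : ℕ}

open scoped Classical in
-- Nonadjacency keeps `x` and `z` out of the candidate leaves, so only `y` is discarded. The union
-- of the candidates has |N(x) \ N(z)| + deg z - 1 elements, and h + k of them would give a copy.
lemma Free.card_sdiff_add_degree_le (hG : (quasiDoubleStar h k).Free G) {x y z : V}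
    (hxy : G.Adj x y) (hyz : G.Adj y z) (hxz : x ≠ z) (hnxz : ¬ G.Adj x z)
    (hx : h + 1 ≤ G.degree x) (hz : k + 1 ≤ G.degree z) :
    #(G.neighborFinset x \ G.neighborFinset z) + G.degree z ≤ h + k := by
  by_contra! hlt
  refine hG (quasiDoubleStar_isContained hxy hyz hxz (A := (G.neighborFinset x).erase y)
    (B := (G.neighborFinset z).erase y) ?_ ?_ ?_ ?_ ?_)
  · intro v hv
    rw [mem_erase, mem_neighborFinset] at hv
    exact ⟨hv.2, hv.1, fun h => hnxz (h ▸ hv.2)⟩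
  · intro v hv
    rw [mem_erase, mem_neighborFinset] at hv
    exact ⟨hv.2, fun h => hnxz (h ▸ hv.2).symm, hv.1⟩
  · rw [card_erase_of_mem (by simpa), card_neighborFinset_eq_degree]
    omega
  · rw [card_erase_of_mem (by simpa using hyz.symm), card_neighborFinset_eq_degree]
    omega
  · rw [← erase_union_distrib, card_erase_of_mem (by simp [hxy]), ← sdiff_union_self_eq_union,
      card_union_of_disjoint sdiff_disjoint, card_neighborFinset_eq_degree]
    omega

open scoped Classical in
-- Apart from `x` and `y`, the vertex `z` still has h + k neighbours, enough for its `k` leaves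
-- whichever `h` leaves `x` uses.
lemma Free.degree_le_of_triangle (hG : (quasiDoubleStar h k).Free G) {x y z : V}
    (hxy : G.Adj x y) (hyz : G.Adj y z) (hxz : G.Adj x z) (hz : h + k + 2 ≤ G.degree z) :
    G.degree x ≤ h + 1 := by
  by_contra! hlt
  have hB : h + k ≤ #(((G.neighborFinset z).erase y).erase x) := by
    rw [card_erase_of_mem (by simpa using ⟨hxy.ne, hxz.symm⟩),
      card_erase_of_mem (by simpa using hyz.symm), card_neighborFinset_eq_degree]
    omega
  refine hG (quasiDoubleStar_isContained hxy hyz hxz.ne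
    (A := ((G.neighborFinset x).erase y).erase z)
    (B := ((G.neighborFinset z).erase y).erase x) ?_ ?_ ?_ ?_ ?_)
  · intro v hv
    simp only [mem_erase, mem_neighborFinset] at hv
    exact ⟨hv.2.2, hv.2.1, hv.1⟩
  · intro v hv
    simp only [mem_erase, mem_neighborFinset] at hv
    exact ⟨hv.2.2, hv.1, hv.2.1⟩
  · rw [card_erase_of_mem (by simpa using ⟨hyz.ne', hxz⟩),
      card_erase_of_mem (by simpa using hxy), card_neighborFinset_eq_degree]
    omega
  · omega
  · exact hB.trans (card_le_card subset_union_right)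

open scoped Classical in
/-- A graph on `A` that satisfies the edge bounds of planar graphs and is `W_{h,k}`-free, and in
which every nonempty set `S` of vertices meets more than `a |S| / (2 b)` edges. -/
structure IsCritical (G : SimpleGraph V) (A : Finset V) (h k a b : ℕ) : Prop where
  mem_of_adj : ∀ ⦃u v⦄, G.Adj u v → u ∈ A
  adjCount_self_le : ∀ S : Finset V, 3 ≤ #S → G.adjCount S S + 12 ≤ 6 * #S
  adjCount_le : ∀ S T : Finset V, Disjoint S T → 3 ≤ #S + #T →
    G.adjCount S T + 4 ≤ 2 * (#S + #T)
  free : (quasiDoubleStar h k).Free G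
  lt : ∀ S ⊆ A, S.Nonempty → a * #S < b * (G.adjCount S S + 2 * G.adjCount S (univ \ S))

namespace IsCritical

variable (hG : G.IsCritical A h k a b)
include hG

open scoped Classical in
lemma lt_degree {v : V} (hv : v ∈ A) : a < b * (2 * G.degree v) := by
  have h1 := hG.lt {v} (by simpa) (singleton_nonempty v)
  rw [adjCount_eq_zero (T := {v}) (by simp), adjCount_eq_sum_degree (T := univ \ {v})] at h1
  · simpa using h1
  · simp only [mem_singleton, mem_sdiff, mem_univ, true_and]
    rintro u rfl w h
    exact h.ne'

open scoped Classical in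
lemma lt_of_closed {S : Finset V} (hS : S.Nonempty) (hSA : S ⊆ A)
    (hc : ∀ u ∈ S, ∀ v, G.Adj u v → v ∈ S) : a * #S < b * G.adjCount S S := by
  have h1 := hG.lt S hSA hS
  rwa [adjCount_eq_zero (T := univ \ S), mul_zero, add_zero] at h1
  intro u hu v hv huv
  exact (mem_sdiff.1 hv).2 (hc u hu v huv)

open scoped Classical in
lemma exists_lt_degree (hA : A.Nonempty) : ∃ z ∈ A, a < b * G.degree z := by
  by_contra! hcon
  have hc : ∀ u ∈ A, ∀ v, G.Adj u v → v ∈ A := fun u _ v huv => hG.mem_of_adj huv.symm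
  have h1 := hG.lt_of_closed hA subset_rfl hc
  rw [adjCount_eq_sum_degree hc, mul_sum] at h1
  have h2 := sum_le_card_nsmul A (fun v => b * G.degree v) a hcon
  rw [smul_eq_mul, mul_comm] at h2
  omega

open scoped Classical in
/-- In a critical graph no vertex has degree greater than `h + k`. -/
lemma degree_le (hh : 1 ≤ h) (hab : 6 * b * (h + k) ≤ a * (h + k + 2)) (hab' : b * (h + 2) ≤ a)
    (hdeg : ∀ v ∈ A, h + 1 ≤ G.degree v) {z : V} (hz : z ∈ A) : G.degree z ≤ h + k := by
  by_contra! hlt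
  -- A vertex at distance two from `z` would violate |N(x) \ N(z)| + deg z ≤ h + k, so the closed
  -- neighborhood of `z` is a component.
  have hclosed : ∀ y ∈ G.neighborFinset z, ∀ x, G.Adj y x → x ∈ insert z (G.neighborFinset z) := by
    intro y hy x hyx
    rw [mem_neighborFinset] at hy
    by_contra hx
    rw [mem_insert, mem_neighborFinset, not_or] at hx
    have h1 := hG.free.card_sdiff_add_degree_le hyx.symm hy.symm hx.1 (fun h => hx.2 h.symm)
      (hdeg x (hG.mem_of_adj hyx.symm)) (by omega)
    omega
  have hclosed' : ∀ u ∈ insert z (G.neighborFinset z), ∀ v, G.Adj u v →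
      v ∈ insert z (G.neighborFinset z) := by
    intro u hu v huv
    rcases mem_insert.1 hu with rfl | hu
    · exact mem_insert_of_mem (by simpa)
    · exact hclosed u hu v huv
  have hcard : #(insert z (G.neighborFinset z)) = G.degree z + 1 := by
    rw [card_insert_of_notMem (by simp), card_neighborFinset_eq_degree]
  have hsub : insert z (G.neighborFinset z) ⊆ A := by
    refine insert_subset hz fun y hy => ?_
    rw [mem_neighborFinset] at hy
    exact hG.mem_of_adj hy.symm
  have h1 := hG.lt_of_closed (insert_nonempty _ _) hsub hclosed'
  rw [hcard] at h1
  -- In degree h + k + 1 the component has h + k + 2 vertices and the planar bound is already too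
  -- small.
  rcases eq_or_lt_of_le (Nat.succ_le_of_lt hlt) with heq | hlt'
  · have h2 := hG.adjCount_self_le (insert z (G.neighborFinset z)) (by omega)
    rw [hcard] at h2
    have h3 : G.adjCount (insert z (G.neighborFinset z)) (insert z (G.neighborFinset z)) ≤
      6 * (h + k) := by omega
    have h4 := Nat.mul_le_mul_left b h3
    rw [← heq] at h1
    nlinarith
  -- In larger degree every neighbor of `z` lies in a triangle with `z`, so the degree sum of the
  -- component is at most (h + 2) deg z.
  · have h2 : ∀ y ∈ G.neighborFinset z, G.degree y ≤ h + 1 := by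
      intro y hy
      have hzy := (mem_neighborFinset ..).1 hy
      have h3 : 1 < #(G.neighborFinset y) := by
        have := hdeg y (hG.mem_of_adj hzy.symm)
        rw [card_neighborFinset_eq_degree]
        omega
      obtain ⟨x, hx, hxz⟩ := exists_mem_ne h3 z
      rw [mem_neighborFinset] at hx
      have h4 := (mem_insert.1 (hclosed y hy x hx)).resolve_left hxz
      rw [mem_neighborFinset] at h4
      exact hG.free.degree_le_of_triangle hx h4.symm hzy.symm (by omega)
    have h3 := sum_le_card_nsmul _ _ _ h2
    rw [adjCount_eq_sum_degree hclosed', sum_insert (by simp)] at h1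
    rw [card_neighborFinset_eq_degree, smul_eq_mul] at h3
    have h4 : a * (G.degree z + 1) < b * (G.degree z + G.degree z * (h + 1)) :=
      h1.trans_le (Nat.mul_le_mul_left b (by omega))
    nlinarith

open scoped Classical in
/-- The component of a vertex `z` of degree `h + k` consists of its neighborhood and of an
independent set. -/
lemma exists_independent (hh : 1 ≤ h) (hdeg : ∀ v ∈ A, h + 1 ≤ G.degree v) {z : V}
    (hz : G.degree z = h + k) :
    ∃ Z : Finset V, Disjoint (G.neighborFinset z) Z ∧
      (∀ x, x ∈ Z ↔ ¬ G.Adj z x ∧ (x = z ∨ ∃ y, G.Adj z y ∧ G.Adj y x)) ∧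
      (∀ x ∈ Z, ∀ v, G.Adj x v → G.Adj z v) ∧
      ∀ y, G.Adj z y → ∀ v, G.Adj y v → v ∈ G.neighborFinset z ∪ Z := by
  refine ⟨univ.filter fun x => ¬ G.Adj z x ∧ (x = z ∨ ∃ y, G.Adj z y ∧ G.Adj y x), ?_, by simp,
    ?_, ?_⟩
  · rw [Finset.disjoint_left]
    intro x hx hx'
    rw [mem_neighborFinset] at hx
    exact (mem_filter.1 hx').2.1 hx
  · intro x hx v hxv
    obtain ⟨-, hzx, rfl | ⟨y, hzy, hyx⟩⟩ := mem_filter.1 hx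
    · exact hxv
    by_cases hxz : x = z
    · exact hxz ▸ hxv
    -- Since deg z = h + k, nothing is left for N(x) \ N(z).
    have h1 := hG.free.card_sdiff_add_degree_le hyx.symm hzy.symm hxz (fun h => hzx h.symm)
      (hdeg x (hG.mem_of_adj hyx.symm)) (by omega)
    rw [hz, add_le_iff_nonpos_left, Nat.le_zero, card_eq_zero, sdiff_eq_empty_iff_subset] at h1
    have h2 := h1 ((mem_neighborFinset ..).2 hxv)
    rwa [mem_neighborFinset] at h2
  · intro y hzy v hyv
    by_cases hv : G.Adj z v
    · exact mem_union_left _ (by simpa)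
    · exact mem_union_right _ (mem_filter.2 ⟨mem_univ _, hv, Or.inr ⟨y, hzy, hyv⟩⟩)

open scoped Classical in
-- Here f is twice the number of edges inside N(z), and c counts the edges between N(z) and `Z`. As
-- `Z` is independent, the component has degree sum f + 2c.
lemma numeric_of_independent (hdeg' : ∀ v ∈ A, G.degree v ≤ h + k) {z : V}
    (hz : G.degree z = h + k) (hk : 2 < h + k) {Z : Finset V}
    (hd : Disjoint (G.neighborFinset z) Z) (hzZ : z ∈ Z)
    (hZA : Z ⊆ A) (h1 : ∀ x ∈ Z, ∀ v, G.Adj x v → G.Adj z v)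
    (h2 : ∀ y, G.Adj z y → ∀ v, G.Adj y v → v ∈ G.neighborFinset z ∪ Z) :
    ∃ f c : ℕ, Even f ∧ c = ∑ x ∈ Z, G.degree x ∧
      f + c = ∑ y ∈ G.neighborFinset z, G.degree y ∧
      f + c ≤ (h + k) * (h + k) ∧ c + 4 ≤ 2 * (h + k + #Z) ∧ f + 2 * c + 12 ≤ 6 * (h + k + #Z) ∧
      a * (h + k + #Z) < b * (f + 2 * c) := by
  set K := G.neighborFinset z with hK
  have hKc : #K = h + k := by rw [hK, card_neighborFinset_eq_degree, hz]
  have hKA : K ⊆ A := fun y hy => by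
    rw [hK, mem_neighborFinset] at hy
    exact hG.mem_of_adj hy.symm
  have hcard : #(K ∪ Z) = h + k + #Z := by rw [card_union_of_disjoint hd, hKc]
  have hZdeg : G.adjCount K Z = ∑ x ∈ Z, G.degree x := by
    rw [adjCount_comm]
    exact adjCount_eq_sum_degree fun x hx v hv => by simpa [hK] using h1 x hx v hv
  have hKdeg : G.adjCount K K + G.adjCount K Z = ∑ y ∈ K, G.degree y := by
    rw [← adjCount_union_right K hd]
    exact adjCount_eq_sum_degree fun x hx v hv => h2 x (by simpa [hK] using hx) v hv
  have hZZ : G.adjCount Z Z = 0 := adjCount_eq_zero fun x hx y hy hxy =>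
    Finset.disjoint_left.1 hd ((mem_neighborFinset ..).2 (h1 x hx y hxy)) hy
  have htot : G.adjCount (K ∪ Z) (K ∪ Z) = G.adjCount K K + 2 * G.adjCount K Z := by
    rw [adjCount_union_left hd, adjCount_union_right _ hd, adjCount_union_right _ hd, hZZ,
      adjCount_comm Z K]
    ring
  refine ⟨G.adjCount K K, G.adjCount K Z, even_adjCount_self K, hZdeg, hKdeg, ?_, ?_, ?_, ?_⟩
  · rw [hKdeg, ← hKc]
    simpa using sum_le_card_nsmul K (fun y => G.degree y) #K
      fun y hy => hKc ▸ hdeg' y (hKA hy)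
  · rw [← hKc]
    exact hG.adjCount_le K Z hd (by omega)
  · rw [← htot, ← hcard]
    exact hG.adjCount_self_le _ (by omega)
  · rw [← htot, ← hcard]
    refine hG.lt_of_closed ⟨z, mem_union_right _ hzZ⟩ (union_subset hKA hZA) ?_
    intro u hu v huv
    rcases mem_union.1 hu with hu | hu
    · exact h2 u (by simpa [hK] using hu) v huv
    · exact mem_union_left _ (by simpa [hK] using h1 u hu v huv)

end IsCritical

end Critical

end SimpleGraph

namespace SimpleGraph

/-! ### Excluding critical graphs for each value of h + k -/

namespace IsCritical

variable {V : Type*} [Fintype V] {G : SimpleGraph V} {A : Finset V} {h k a b : ℕ}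

open scoped Classical in
lemma false_of_add_eq_three (hG : G.IsCritical A h k 18 5) (hA : A.Nonempty) (hh : h = 1)
    (hs : h + k = 3) : False := by
  obtain ⟨z, hz, hlt⟩ := hG.exists_lt_degree hA
  have := hG.degree_le (by omega) (by omega) (by omega)
    (fun v hv => by have := hG.lt_degree hv; omega) hz
  omega

open scoped Classical in
lemma false_of_add_eq_four (hG : G.IsCritical A h k 4 1) (hA : A.Nonempty) (hh : 1 ≤ h)
    (hh' : h ≤ 2) (hs : h + k = 4) : False := by
  obtain ⟨z, hz, hlt⟩ := hG.exists_lt_degree hA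
  have := hG.degree_le (by omega) (by omega) (by omega)
    (fun v hv => by have := hG.lt_degree hv; omega) hz
  omega

open scoped Classical in
lemma false_of_add_eq_six (hG : G.IsCritical A h k 5 1) (hA : A.Nonempty) (hh : 1 ≤ h)
    (hh' : h ≤ 2) (hs : h + k = 6) : False := by
  obtain ⟨z, hz, hlt⟩ := hG.exists_lt_degree hA
  have hdeg : ∀ v ∈ A, h + 1 ≤ G.degree v := fun v hv => by have := hG.lt_degree hv; omega
  have hdeg' : ∀ v ∈ A, G.degree v ≤ h + k := fun v hv =>
    hG.degree_le (by omega) (by omega) (by omega) hdeg hv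
  have hz' : G.degree z = h + k := by have := hdeg' z hz; omega
  obtain ⟨Z, hd, hZ, h1, h2⟩ := hG.exists_independent hh hdeg hz'
  have hZA : Z ⊆ A := fun x hx => by
    rcases ((hZ x).1 hx).2 with rfl | ⟨y, -, hyx⟩
    exacts [hz, hG.mem_of_adj hyx.symm]
  obtain ⟨f, c, -, -, -, h3, h4, h5, h6⟩ := hG.numeric_of_independent hdeg' hz' (by omega) hd
    ((hZ z).2 (by simp)) hZA h1 h2
  rw [hs] at h3 h4 h5 h6
  -- The degree and bipartite bounds give f + 2c ≤ 44 + 2|Z|, forcing |Z| ≤ 4; the planar bound f +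
  -- 2c ≤ 24 + 6|Z| forces |Z| > 6.
  omega

open scoped Classical in
lemma degree_ne_seven (hG : G.IsCritical A h k 17 3) (hh : 1 ≤ h)
    (hdeg : ∀ v ∈ A, h + 1 ≤ G.degree v) (hdeg' : ∀ v ∈ A, G.degree v ≤ h + k)
    (hs : h + k = 7) {z : V} (hz : z ∈ A) : G.degree z ≠ h + k := by
  intro hz'
  obtain ⟨Z, hd, hZ, h1, h2⟩ := hG.exists_independent hh hdeg hz'
  have hZA : Z ⊆ A := fun x hx => by
    rcases ((hZ x).1 hx).2 with rfl | ⟨y, -, hyx⟩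
    exacts [hz, hG.mem_of_adj hyx.symm]
  obtain ⟨f, c, -, -, -, h3, h4, h5, h6⟩ := hG.numeric_of_independent hdeg' hz' (by omega) hd
    ((hZ z).2 (by simp)) hZA h1 h2
  rw [hs] at h3 h4 h5 h6
  -- As for h + k = 6: the degree and bipartite bounds force |Z| ≤ 5, the planar bound |Z| > 29.
  omega

open scoped Classical in
-- The maximum degree is now 6 = h + k - 1, so a vertex at distance two from `z` may have one
-- neighbor outside N(z). Thus `K ∪ Z` need not be a component, and the edges leaving it are counted
-- as well.
lemma false_of_two_five (hG : G.IsCritical A 2 5 17 3) (hA : A.Nonempty) : False := by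
  obtain ⟨z, hz, hlt⟩ := hG.exists_lt_degree hA
  have hdeg : ∀ v ∈ A, 2 + 1 ≤ G.degree v := fun v hv => by have := hG.lt_degree hv; omega
  have hdeg' : ∀ v ∈ A, G.degree v ≤ 6 := fun v hv => by
    have h1 : ∀ v ∈ A, G.degree v ≤ 2 + 5 := fun v hv =>
      hG.degree_le (by omega) (by omega) (by omega) hdeg hv
    have h2 := h1 v hv
    have h3 := hG.degree_ne_seven (by omega) hdeg h1 rfl hv
    omega
  have hz6 : G.degree z = 6 := by have := hdeg' z hz; omega
  set K := G.neighborFinset z with hK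
  have hmK : ∀ v, v ∈ K ↔ G.Adj z v := fun v => mem_neighborFinset ..
  have hKc : #K = 6 := by rw [hK, card_neighborFinset_eq_degree, hz6]
  have hKA : K ⊆ A := fun y hy => hG.mem_of_adj ((hmK y).1 hy).symm
  have hzK : z ∉ K := by simp [hK]
  let Z : Finset V := univ.filter fun x => x ∉ K ∧ (x = z ∨ ∃ y ∈ K, G.Adj y x)
  have hmZ : ∀ x, x ∈ Z ↔ x ∉ K ∧ (x = z ∨ ∃ y ∈ K, G.Adj y x) := fun x => by simp [Z]
  have hzZ : z ∈ Z := (hmZ z).2 ⟨hzK, Or.inl rfl⟩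
  have hd : Disjoint K Z := Finset.disjoint_left.2 fun x hx hx' => ((hmZ x).1 hx').1 hx
  have hZA : Z ⊆ A := fun x hx => by
    rcases ((hmZ x).1 hx).2 with rfl | ⟨y, -, hyx⟩
    exacts [hz, hG.mem_of_adj hyx.symm]
  have hKcl : ∀ u ∈ K, ∀ v, G.Adj u v → v ∈ K ∪ Z := fun u hu v huv => by
    by_cases hv : v ∈ K
    · exact mem_union_left _ hv
    · exact mem_union_right _ ((hmZ v).2 ⟨hv, Or.inr ⟨u, hu, huv⟩⟩)
  have hcard : #(K ∪ Z) = 6 + #Z := by rw [card_union_of_disjoint hd, hKc]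
  have hmeet := hG.lt (K ∪ Z) (union_subset hKA hZA) ⟨z, mem_union_right _ hzZ⟩
  have hKdeg : G.adjCount K K + G.adjCount K Z ≤ 36 := by
    rw [← adjCount_union_right K hd, adjCount_eq_sum_degree hKcl]
    simpa [hKc] using sum_le_card_nsmul K (fun y => G.degree y) 6 fun y hy => hdeg' y (hKA hy)
  have hKZ := hG.adjCount_le K Z hd (by omega)
  -- The planar bound on the seven vertices of `{z} ∪ K`, six of whose edges are at `z`.
  have hKK : G.adjCount K K + 24 ≤ 42 := by
    have h1 := hG.adjCount_self_le ({z} ∪ K) (by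
      rw [card_union_of_disjoint (by simpa), hKc]; simp)
    have h2 : G.adjCount {z} K = 6 := by
      rw [adjCount_eq_sum_degree (by simp [hmK]), sum_singleton, hz6]
    rw [card_union_of_disjoint (by simpa), hKc, card_singleton, adjCount_union_left (by simpa),
      adjCount_union_right _ (by simpa), adjCount_union_right _ (by simpa), adjCount_comm K {z},
      h2, adjCount_eq_zero (S := {z}) (T := {z}) (by simp)] at h1
    omega
  -- The vertex `z` has no neighbor outside `K`, every other vertex of `Z` at most one.
  have hout : G.adjCount Z Z + G.adjCount Z (univ \ (K ∪ Z)) + 1 ≤ #Z := by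
    have hdisj : Disjoint Z (univ \ (K ∪ Z)) :=
      disjoint_sdiff.mono_left subset_union_right
    rw [← adjCount_union_right _ hdisj, adjCount_eq_sum, ← add_sum_erase _ _ hzZ]
    have h0 : ∀ x, G.neighborFinset x ∩ (Z ∪ univ \ (K ∪ Z)) ⊆ G.neighborFinset x \ K := by
      intro x v hv
      rw [mem_inter, mem_union] at hv
      refine mem_sdiff.2 ⟨hv.1, fun hvK => ?_⟩
      rcases hv.2 with h | h
      · exact Finset.disjoint_left.1 hd hvK h
      · exact (mem_sdiff.1 h).2 (mem_union_left _ hvK)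
    have h1 : #(G.neighborFinset z ∩ (Z ∪ univ \ (K ∪ Z))) = 0 := by
      have := h0 z
      rwa [← hK, sdiff_self, bot_eq_empty, subset_empty, ← card_eq_zero] at this
    have h2 : ∀ x ∈ Z.erase z, #(G.neighborFinset x ∩ (Z ∪ univ \ (K ∪ Z))) ≤ 1 := by
      intro x hx
      obtain ⟨hxz, hx⟩ := mem_erase.1 hx
      obtain ⟨hxK, hx⟩ := (hmZ x).1 hx
      obtain ⟨y, hy, hyx⟩ := hx.resolve_left hxz
      refine (card_le_card (h0 x)).trans ?_
      have := hG.free.card_sdiff_add_degree_le hyx.symm ((hmK y).1 hy).symm hxz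
        (fun h => hxK ((hmK x).2 h.symm)) (hdeg x (hG.mem_of_adj hyx.symm)) (by omega)
      change #(_ \ K) + _ ≤ _ at this
      omega
    have h3 := sum_le_card_nsmul _ _ _ h2
    have h4 : 0 < #Z := card_pos.2 ⟨z, hzZ⟩
    rw [card_erase_of_mem hzZ, smul_eq_mul, mul_one] at h3
    omega
  have hK0 : G.adjCount K (univ \ (K ∪ Z)) = 0 := adjCount_eq_zero fun u hu v hv huv =>
    (mem_sdiff.1 hv).2 (hKcl u hu v huv)
  rw [hcard, adjCount_union_left hd, adjCount_union_left hd, hK0, adjCount_union_right _ hd,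
    adjCount_union_right _ hd, adjCount_comm Z K] at hmeet
  -- The degree sum over `K` and the bipartite bound force |Z| ≤ 4; `hKK` and the bipartite bound
  -- force |Z| > 6.
  omega

open scoped Classical in
lemma false_of_add_eq_five (hG : G.IsCritical A h k 30 7) (hA : A.Nonempty) (hh : 1 ≤ h)
    (hh' : h ≤ 2) (hs : h + k = 5) : False := by
  obtain ⟨z, hz, hlt⟩ := hG.exists_lt_degree hA
  have hdeg3 : ∀ v ∈ A, 3 ≤ G.degree v := fun v hv => by have := hG.lt_degree hv; omega
  have hdeg : ∀ v ∈ A, h + 1 ≤ G.degree v := fun v hv => by have := hdeg3 v hv; omega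
  have hdeg' : ∀ v ∈ A, G.degree v ≤ h + k := fun v hv =>
    hG.degree_le (by omega) (by omega) (by omega) hdeg hv
  have hz' : G.degree z = 5 := by have := hdeg' z hz; omega
  have key : ∀ u ∈ A, G.degree u = 5 →
      24 ≤ ∑ y ∈ G.neighborFinset u, G.degree y ∧
      ∀ v, v ≠ u → ¬ G.Adj u v → (∃ y, G.Adj u y ∧ G.Adj y v) → G.degree v ≠ 5 := by
    intro u hu hu5
    obtain ⟨Z, hd, hZ, h1, h2⟩ := hG.exists_independent hh hdeg (hu5.trans hs.symm)
    have huZ : u ∈ Z := (hZ u).2 (by simp)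
    have hZA : Z ⊆ A := fun x hx => by
      rcases ((hZ x).1 hx).2 with rfl | ⟨y, -, hyx⟩
      exacts [hu, hG.mem_of_adj hyx.symm]
    obtain ⟨f, c, ⟨m, hm⟩, hc, hfc, h3, h4, h5, h6⟩ :=
      hG.numeric_of_independent hdeg' (hu5.trans hs.symm) (by omega) hd huZ hZA h1 h2
    rw [hs] at h3 h4 h5 h6
    -- The inequalities allow |Z| = 4 only with f = 11, which parity excludes. For |Z| = 3 they and
    -- parity give f + 2c = 36 and c ≤ 12, hence f + c ≥ 24.
    have hZ3 : #Z = 3 := by omega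
    refine ⟨by omega, fun v hvu huv hy hv5 => ?_⟩
    have hvZ : v ∈ Z.erase u := mem_erase.2 ⟨hvu, (hZ v).2 ⟨huv, Or.inr hy⟩⟩
    have hc' : #((Z.erase u).erase v) = 1 := by
      rw [card_erase_of_mem hvZ, card_erase_of_mem huZ, hZ3]
    obtain ⟨w, hw⟩ := card_eq_one.1 hc'
    rw [← add_sum_erase _ _ huZ, ← add_sum_erase _ _ hvZ, hw, sum_singleton, hu5, hv5] at hc
    have hwZ : w ∈ (Z.erase u).erase v := by rw [hw]; exact mem_singleton_self w
    have := hdeg3 w (hZA (mem_of_mem_erase (mem_of_mem_erase hwZ)))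
    -- Two vertices of degree 5 in `Z` would give c ≥ 5 + 5 + 3 > 12.
    omega
  set K := G.neighborFinset z with hK
  have hmK : ∀ v, v ∈ K ↔ G.Adj z v := fun v => mem_neighborFinset ..
  have hKc : #K = 5 := by rw [hK, card_neighborFinset_eq_degree, hz']
  have hKA : K ⊆ A := fun y hy => hG.mem_of_adj ((hmK y).1 hy).symm
  let D : Finset V := K.filter fun v => G.degree v = 5
  have hD : 4 ≤ #D := by
    have h1 : ∑ y ∈ K, G.degree y ≤ ∑ y ∈ K, (4 + if G.degree y = 5 then 1 else 0) :=
      sum_le_sum fun y hy => by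
        have := hdeg' y (hKA hy)
        split_ifs <;> omega
    rw [sum_add_distrib, sum_const, hKc, ← card_filter] at h1
    have h2 : 24 ≤ ∑ y ∈ K, G.degree y := (key z hz hz').1
    simp only [smul_eq_mul] at h1
    change _ ≤ 5 * 4 + #D at h1
    omega
  have hzD : z ∉ D := fun h => by simp [D, hK] at h
  obtain ⟨D', hD', hc'⟩ := exists_subset_card_eq (s := insert z D) (n := 5) (by
    rw [card_insert_of_notMem hzD]; omega)
  -- Two vertices of degree 5 with a common neighbor must be adjacent, so `insert z D` is a clique.
  -- Five of its vertices have 20 ordered adjacent pairs, against the planar bound 18.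
  have hcl : ∀ u ∈ insert z D, ∀ v ∈ insert z D, u ≠ v → G.Adj u v := by
    intro u hu v hv huv
    rw [mem_insert, mem_filter, hmK] at hu hv
    rcases hu with rfl | ⟨hzu, hu⟩ <;> rcases hv with rfl | ⟨hzv, hv⟩
    · exact absurd rfl huv
    · exact hzv
    · exact hzu.symm
    · by_contra hnadj
      exact (key u (hG.mem_of_adj hzu.symm) hu).2 v huv.symm hnadj ⟨z, hzu.symm, hzv⟩ hv
  have h1 := hG.adjCount_self_le D' (by omega)
  have h2 : #D' • 4 ≤ ∑ u ∈ D', #(G.neighborFinset u ∩ D') := by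
    refine card_nsmul_le_sum _ _ _ fun u hu => ?_
    have h3 : #(D'.erase u) = 4 := by rw [card_erase_of_mem hu, hc']
    rw [← h3]
    refine card_le_card fun v hv => ?_
    obtain ⟨hvu, hv⟩ := mem_erase.1 hv
    exact mem_inter.2 ⟨(mem_neighborFinset ..).2 (hcl u (hD' hu) v (hD' hv) hvu.symm), hv⟩
  rw [← adjCount_eq_sum, hc', smul_eq_mul] at h2
  omega

end IsCritical

open scoped Classical in
/-- Removing a set of vertices that meets few edges: the edge bound for planar `W_{h,k}`-free graphs
holds as soon as there is no critical graph. -/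
lemma IsPlanar.adjCount_le_of_not_isCritical {V : Type*} [Fintype V] {G : SimpleGraph V}
    (hG : G.IsPlanar) {h k a b : ℕ} (hf : (quasiDoubleStar h k).Free G)
    (hcrit : ∀ (H : SimpleGraph V) (A : Finset V), A.Nonempty → ¬ H.IsCritical A h k a b)
    (A : Finset V) : b * G.adjCount A A ≤ a * #A := by
  induction A using Finset.strongInduction with
  | H A ih =>
  rcases A.eq_empty_or_nonempty with rfl | hA
  · simp [adjCount]
  by_contra! hlt
  -- Restrict to the minimal violating set `A`. As `A \ S` obeys the bound, the excess must come
  -- from the edges meeting `S`.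
  let H : SimpleGraph V :=
    { Adj := fun u v => G.Adj u v ∧ u ∈ A ∧ v ∈ A
      symm := ⟨fun u v h => ⟨h.1.symm, h.2.2, h.2.1⟩⟩
      loopless := ⟨fun u h => h.1.ne rfl⟩ }
  have hHG : H ≤ G := fun u v h => h.1
  refine hcrit H A hA ⟨fun u v h => h.2.1, fun S hS => ?_, fun S T hST hc => ?_, ?_, ?_⟩
  · exact (Nat.add_le_add_right (adjCount_mono_graph hHG S S) 12).trans (hG.adjCount_self_le S hS)
  · exact (Nat.add_le_add_right (adjCount_mono_graph hHG S T) 4).trans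
      (hG.adjCount_le_of_disjoint hST hc)
  · exact fun hc => hf (hc.trans (IsContained.of_le hHG))
  · intro S hSA hS
    have h1 := ih (A \ S) (sdiff_ssubset hSA hS)
    have h2 : H.adjCount S S = G.adjCount S S := by
      rw [adjCount_eq_card, adjCount_eq_card]
      congr 1
      ext p
      have h1 := @hSA p.1
      have h2 := @hSA p.2
      have hH : H.Adj p.1 p.2 ↔ G.Adj p.1 p.2 ∧ p.1 ∈ A ∧ p.2 ∈ A := Iff.rfl
      simp only [mem_filter, mem_product, hH]
      tauto
    have h3 : H.adjCount S (univ \ S) = G.adjCount S (A \ S) := by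
      rw [adjCount_eq_card, adjCount_eq_card]
      congr 1
      ext p
      have := @hSA p.1
      have hH : H.Adj p.1 p.2 ↔ G.Adj p.1 p.2 ∧ p.1 ∈ A ∧ p.2 ∈ A := Iff.rfl
      simp only [mem_filter, mem_product, mem_sdiff, mem_univ, true_and, hH]
      tauto
    have h4 : G.adjCount A A = G.adjCount S S + 2 * G.adjCount S (A \ S) +
        G.adjCount (A \ S) (A \ S) := by
      conv_lhs => rw [← union_sdiff_of_subset hSA]
      rw [adjCount_union_left disjoint_sdiff, adjCount_union_right _ disjoint_sdiff,
        adjCount_union_right _ disjoint_sdiff, adjCount_comm (A \ S) S]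
      ring
    have h5 := card_sdiff_add_card_eq_card hSA
    rw [h2, h3]
    rw [h4, ← h5] at hlt
    nlinarith

open scoped Classical in
lemma adjCount_univ {V : Type*} [Fintype V] (G : SimpleGraph V) :
    G.adjCount univ univ = 2 * #G.edgeFinset := by
  rw [adjCount_eq_sum_degree (by simp), sum_degrees_eq_twice_card_edges]

lemma planarTuranNumber_le {h k a b : ℕ} (n : ℕ)
    (hcrit : ∀ (H : SimpleGraph (Fin n)) (A : Finset (Fin n)), A.Nonempty →
      ¬ H.IsCritical A h k a b) :
    2 * b * planarTuranNumber n (quasiDoubleStar h k) ≤ a * n := by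
  classical
  unfold planarTuranNumber
  obtain hS | ⟨G, hG, hmax⟩ := (Finset.eq_empty_or_nonempty ({G : SimpleGraph (Fin n) |
    G.IsPlanar ∧ (quasiDoubleStar h k).Free G} : Finset _)).imp_right
    fun hS => Finset.exists_mem_eq_sup _ hS fun G => G.edgeFinset.card
  · rw [hS, sup_empty]
    simp
  · rw [hmax]
    rw [mem_filter] at hG
    have h1 := hG.2.1.adjCount_le_of_not_isCritical hG.2.2 hcrit univ
    rw [adjCount_univ, card_univ, Fintype.card_fin] at h1
    linarith

end SimpleGraph

lemma Equiv.Perm.SameCycle.of_semiconj {α β : Type*} {p : Equiv.Perm α} {q : Equiv.Perm β}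
    (f : α → β) (h : ∀ x, f (p x) = q (f x)) {x y : α} (hxy : p.SameCycle x y) :
    q.SameCycle (f x) (f y) := by
  have hsymm : ∀ x, f (p⁻¹ x) = q⁻¹ (f x) := fun x => by
    rw [Equiv.Perm.eq_inv_iff_eq, ← h]
    simp
  have key : ∀ n : ℤ, ∀ x, f ((p ^ n) x) = (q ^ n) (f x) := by
    intro n
    induction n using Int.induction_on with
    | zero => simp
    | succ n ih => intro x; rw [zpow_add_one, zpow_add_one, Equiv.Perm.mul_apply, ih, h]; rfl
    | pred n ih => intro x; rw [zpow_sub_one, zpow_sub_one, Equiv.Perm.mul_apply, ih, hsymm]; rfl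
  obtain ⟨n, rfl⟩ := hxy
  exact ⟨n, (key n x).symm⟩

namespace SimpleGraph

/-! ### Planarity of isomorphic copies, disjoint unions and triangulations -/

section Planar

variable {V W : Type*} {G : SimpleGraph V} {H : SimpleGraph W}

/-- If the darts and the isolated vertices can be labelled so that labels are constant along the
boundary walks of the faces, then there are at least as many faces as labels. -/
lemma RotationSystem.card_label_le [Finite V] (R : G.RotationSystem) {X : Type*}
    (l : G.Dart → X) (l' : {v : V // ∀ w, ¬ G.Adj v w} → X) (hl : ∀ d, l (R.next d) = l d.symm)
    (hX : ∀ x, (∃ d, l d = x) ∨ ∃ v, l' v = x) : Nat.card X ≤ Nat.card R.Face := by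
  have hl' : ∀ d, l (R.facePerm d) = l d := fun d => by
    have := hl d.symm
    rwa [Dart.symm_symm] at this
  have hcyc : ∀ d d', R.facePerm.SameCycle d d' → l d = l d' := by
    rintro d d' h
    have h2 := h.of_semiconj (q := 1) l (fun d => hl' d)
    simpa using h2
  refine Nat.card_le_card_of_surjective
    (Sum.elim (Quotient.lift l hcyc) l' : R.Face → X) fun x => ?_
  rcases hX x with ⟨d, rfl⟩ | ⟨v, rfl⟩
  · exact ⟨R.faceOf d, rfl⟩
  · exact ⟨Sum.inr v, rfl⟩

/-- Nonnegativity of the genus supplies the reverse inequality, so constructions need only exhibit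
enough faces. -/
lemma RotationSystem.isPlanar [Finite V] (R : G.RotationSystem)
    (h : Nat.card G.edgeSet + 2 * Nat.card G.ConnectedComponent ≤ Nat.card V + Nat.card R.Face) :
    G.IsPlanar := by
  have := Fintype.ofFinite V
  exact ⟨R, le_antisymm R.card_add_card_face_le h⟩

/-- Transport of a rotation system along a bijection of darts. -/
def RotationSystem.transport {D : Type*} (e : D ≃ G.Dart) (next : Equiv.Perm D)
    (h1 : ∀ d, (e (next d)).fst = (e d).fst)
    (h2 : ∀ d d', (e d).fst = (e d').fst → next.SameCycle d d') : G.RotationSystem where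
  next := e.permCongr next
  next_fst d := by
    obtain ⟨d, rfl⟩ := e.surjective d
    simpa using h1 d
  sameCycle_next d d' h := by
    obtain ⟨d, rfl⟩ := e.surjective d
    obtain ⟨d', rfl⟩ := e.surjective d'
    exact (h2 d d' h).of_semiconj e (by simp)

@[simp] lemma RotationSystem.transport_next {D : Type*} (e : D ≃ G.Dart) (next : Equiv.Perm D)
    (h1 : ∀ d, (e (next d)).fst = (e d).fst)
    (h2 : ∀ d d', (e d).fst = (e d').fst → next.SameCycle d d') (d : D) :
    (RotationSystem.transport e next h1 h2).next (e d) = e (next d) := by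
  simp [RotationSystem.transport]

/-- The bijection of darts induced by an isomorphism. -/
def Iso.dartEquiv (e : G ≃g H) : G.Dart ≃ H.Dart where
  toFun d := ⟨(e d.fst, e d.snd), e.map_adj_iff.2 d.adj⟩
  invFun d := ⟨(e.symm d.fst, e.symm d.snd), e.symm.map_adj_iff.2 d.adj⟩
  left_inv d := by ext <;> simp
  right_inv d := by ext <;> simp

theorem IsPlanar.of_iso [Finite V] [Finite W] (e : G ≃g H) (hG : G.IsPlanar) : H.IsPlanar := by
  obtain ⟨R, hR⟩ := hG
  let R' : H.RotationSystem := RotationSystem.transport e.dartEquiv R.next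
    (fun d => congrArg e (R.next_fst d))
    (fun d d' h => R.sameCycle_next d d' (e.injective h))
  refine R'.isPlanar ?_
  rw [← Nat.card_congr e.mapEdgeSet, ← Nat.card_congr e.connectedComponentEquiv,
    ← Nat.card_congr e.toEquiv, ← hR]
  refine Nat.add_le_add_left (R'.card_label_le (fun d => R.faceOf (e.dartEquiv.symm d))
    (fun v => R.isolatedFace (e.symm v.1) fun w hw => v.2 (e w) ?_) ?_ ?_) _
  · have := e.map_adj_iff.2 hw
    rwa [e.apply_symm_apply] at this
  · intro d
    obtain ⟨d, rfl⟩ := e.dartEquiv.surjective d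
    have h1 : R'.next (e.dartEquiv d) = e.dartEquiv (R.next d) :=
      RotationSystem.transport_next ..
    have h2 : (e.dartEquiv d).symm = e.dartEquiv d.symm := rfl
    rw [h1, h2, Equiv.symm_apply_apply, Equiv.symm_apply_apply, R.faceOf_next]
  · rintro (q | ⟨v, hv⟩)
    · induction q using Quotient.inductionOn with
      | h d => exact Or.inl ⟨e.dartEquiv d, by rw [Equiv.symm_apply_apply]; rfl⟩
    · refine Or.inr ⟨⟨e v, fun w hw => hv (e.symm w) ?_⟩, ?_⟩
      · have := e.symm.map_adj_iff.2 hw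
        rwa [e.symm_apply_apply] at this
      · have h1 : ∀ u (hu : ∀ w, ¬ G.Adj u w), u = v →
            R.isolatedFace u hu = R.isolatedFace v hv := by
          rintro u hu rfl
          rfl
        exact h1 _ _ (e.symm_apply_apply v)

/-- The darts of a disjoint sum. -/
noncomputable def dartSumEquiv (G : SimpleGraph V) (H : SimpleGraph W) :
    G.Dart ⊕ H.Dart ≃ (G ⊕g H).Dart :=
  Equiv.ofBijective
    (Sum.elim (fun d => ⟨(.inl d.fst, .inl d.snd), sum_adj_inl.2 d.adj⟩)
      (fun d => ⟨(.inr d.fst, .inr d.snd), sum_adj_inr.2 d.adj⟩)) <| by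
    constructor
    · rintro (⟨⟨a, b⟩, h⟩ | ⟨⟨a, b⟩, h⟩) (⟨⟨c, d⟩, h'⟩ | ⟨⟨c, d⟩, h'⟩) heq <;>
        simp_all [Dart.ext_iff]
    · rintro ⟨⟨a | a, b | b⟩, h⟩
      · exact ⟨.inl ⟨(a, b), sum_adj_inl.1 h⟩, rfl⟩
      · exact (not_adj_sum_inl_inr _ _ h).elim
      · exact (not_adj_sum_inl_inr _ _ h.symm).elim
      · exact ⟨.inr ⟨(a, b), sum_adj_inr.1 h⟩, rfl⟩

lemma dartSumEquiv_symm (d : G.Dart ⊕ H.Dart) :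
    (dartSumEquiv G H d).symm = dartSumEquiv G H (d.map Dart.symm Dart.symm) := by
  rcases d with d | d <;> rfl

lemma card_connectedComponent_sum_le [Finite V] [Finite W] :
    Nat.card (G ⊕g H).ConnectedComponent ≤
      Nat.card G.ConnectedComponent + Nat.card H.ConnectedComponent := by
  rw [← Nat.card_sum]
  refine Nat.card_le_card_of_surjective
    (Sum.elim (ConnectedComponent.map (Embedding.sumInl (H := H)).toHom)
      (ConnectedComponent.map (Embedding.sumInr (G := G)).toHom)) fun c => ?_
  induction c using ConnectedComponent.ind with
  | h v =>
    rcases v with v | v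
    · exact ⟨.inl (G.connectedComponentMk v), rfl⟩
    · exact ⟨.inr (H.connectedComponentMk v), rfl⟩

theorem IsPlanar.sum [Finite V] [Finite W] (hG : G.IsPlanar) (hH : H.IsPlanar) :
    (G ⊕g H).IsPlanar := by
  obtain ⟨R, hR⟩ := hG
  obtain ⟨S, hS⟩ := hH
  let T : (G ⊕g H).RotationSystem :=
    RotationSystem.transport (dartSumEquiv G H) (Equiv.sumCongr R.next S.next)
      (by
        rintro (d | d)
        · exact congrArg Sum.inl (R.next_fst d)
        · exact congrArg Sum.inr (S.next_fst d))
      (by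
        rintro (d | d) (d' | d') h
        · exact (R.sameCycle_next d d' (Sum.inl_injective h)).of_semiconj Sum.inl fun _ => rfl
        · exact absurd h Sum.inl_ne_inr
        · exact absurd h Sum.inr_ne_inl
        · exact (S.sameCycle_next d d' (Sum.inr_injective h)).of_semiconj Sum.inr fun _ => rfl)
  refine T.isPlanar ?_
  have hF : Nat.card (R.Face ⊕ S.Face) ≤ Nat.card T.Face := by
    refine T.card_label_le
      (fun d => ((dartSumEquiv G H).symm d).map R.faceOf S.faceOf)
      (fun v => match v with
        | ⟨.inl v, hv⟩ => .inl (R.isolatedFace v fun w hw => hv (.inl w) (sum_adj_inl.2 hw))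
        | ⟨.inr v, hv⟩ => .inr (S.isolatedFace v fun w hw => hv (.inr w) (sum_adj_inr.2 hw)))
      ?_ ?_
    · intro d
      obtain ⟨d, rfl⟩ := (dartSumEquiv G H).surjective d
      rw [RotationSystem.transport_next, dartSumEquiv_symm, Equiv.symm_apply_apply,
        Equiv.symm_apply_apply]
      rcases d with d | d
      · exact congrArg Sum.inl (R.faceOf_next d)
      · exact congrArg Sum.inr (S.faceOf_next d)
    · rintro ((q | ⟨v, hv⟩) | (q | ⟨v, hv⟩))
      · induction q using Quotient.inductionOn with
        | h d => exact Or.inl ⟨dartSumEquiv G H (.inl d), by rw [Equiv.symm_apply_apply]; rfl⟩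
      · refine Or.inr ⟨⟨.inl v, ?_⟩, rfl⟩
        rintro (w | w) hw
        exacts [hv w (sum_adj_inl.1 hw), not_adj_sum_inl_inr _ _ hw]
      · induction q using Quotient.inductionOn with
        | h d => exact Or.inl ⟨dartSumEquiv G H (.inr d), by rw [Equiv.symm_apply_apply]; rfl⟩
      · refine Or.inr ⟨⟨.inr v, ?_⟩, rfl⟩
        rintro (w | w) hw
        exacts [not_adj_sum_inl_inr _ _ hw.symm, hv w (sum_adj_inr.1 hw)]
  have hc := card_connectedComponent_sum_le (G := G) (H := H)
  rw [Nat.card_sum] at hF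
  rw [Nat.card_congr edgeSetSumEquiv, Nat.card_sum, Nat.card_sum]
  omega

theorem isPlanar_bot [Finite V] : (⊥ : SimpleGraph V).IsPlanar := by
  have : IsEmpty (⊥ : SimpleGraph V).Dart := ⟨fun d => d.adj⟩
  let R : (⊥ : SimpleGraph V).RotationSystem := ⟨1, isEmptyElim, isEmptyElim⟩
  refine R.isPlanar ?_
  have h1 : Nat.card V ≤ Nat.card R.Face :=
    R.card_label_le isEmptyElim (fun v => v.1) isEmptyElim fun v => Or.inr ⟨⟨v, fun w h => h⟩, rfl⟩
  have h2 : Nat.card (⊥ : SimpleGraph V).ConnectedComponent ≤ Nat.card V :=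
    Nat.card_le_card_of_surjective _ Quot.mk_surjective
  have h3 : Nat.card (⊥ : SimpleGraph V).edgeSet = 0 := by simp
  omega

/-- A copy of a connected graph lies in one summand. -/
theorem Free.sum {U : Type*} {K : SimpleGraph U} (hK : K.Connected) (hG : K.Free G)
    (hH : K.Free H) : K.Free (G ⊕g H) := by
  rintro ⟨f⟩
  obtain ⟨u₀⟩ := hK.nonempty
  have hr : ∀ u, (G ⊕g H).Reachable (f u₀) (f u) := fun u => (hK.preconnected u₀ u).map f.toHom
  rcases h0 : f u₀ with v | v
  · have h1 : ∀ u, ∃ v, f u = .inl v := fun u => by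
      rcases hu : f u with w | w
      · exact ⟨w, rfl⟩
      · exact absurd (h0 ▸ hu ▸ hr u) (not_reachable_sum_inl_inr v w)
    choose g hg using h1
    refine hG ⟨⟨⟨g, fun {a b} hab => ?_⟩, fun a b hab => f.injective ?_⟩⟩
    · have := f.toHom.map_adj hab
      change (G ⊕g H).Adj (f a) (f b) at this
      rwa [hg, hg, sum_adj_inl] at this
    · change f a = f b
      rw [hg, hg]
      exact congrArg Sum.inl hab
  · have h1 : ∀ u, ∃ v, f u = .inr v := fun u => by
      rcases hu : f u with w | w
      · exact absurd (h0 ▸ hu ▸ hr u).symm (not_reachable_sum_inl_inr w v)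
      · exact ⟨w, rfl⟩
    choose g hg using h1
    refine hH ⟨⟨⟨g, fun {a b} hab => ?_⟩, fun a b hab => f.injective ?_⟩⟩
    · have := f.toHom.map_adj hab
      change (G ⊕g H).Adj (f a) (f b) at this
      rwa [hg, hg, sum_adj_inr] at this
    · change f a = f b
      rw [hg, hg]
      exact congrArg Sum.inr hab

/-- A connected graph with `3 |V| - 6` edges is planar if it has a rotation system all of whose
faces are triangles. -/
theorem RotationSystem.isPlanar_of_triangulation [Fintype V] (R : G.RotationSystem)
    (h3 : ∀ d, R.facePerm (R.facePerm (R.facePerm d)) = d) (hG : G.Connected)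
    (hE : Nat.card G.edgeSet + 6 ≤ 3 * Nat.card V) : G.IsPlanar := by
  classical
  refine R.isPlanar ?_
  have := hG.preconnected.subsingleton_connectedComponent
  have hc : Nat.card G.ConnectedComponent ≤ 1 := Finite.card_le_one_iff_subsingleton.2 this
  have := Fintype.ofFinite R.Face
  -- A face carries at most three darts, so 2|E| ≤ 3|F|.
  have h1 : #(univ : Finset G.Dart) ≤ 3 * #(univ : Finset R.Face) := by
    refine card_le_mul_card_image_of_maps_to (f := R.faceOf) (fun _ _ => mem_univ _) 3 ?_
    rintro F -
    rcases ({d | R.faceOf d = F} : Finset G.Dart).eq_empty_or_nonempty with h | ⟨d, hd⟩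
    · rw [h]; simp
    refine (card_le_card (t := {d, R.facePerm d, R.facePerm (R.facePerm d)}) ?_).trans card_le_three
    intro d' hd'
    have hdd' : R.faceOf d = R.faceOf d' :=
      (mem_filter.1 hd).2.trans (mem_filter.1 hd').2.symm
    rw [R.faceOf_eq_iff] at hdd'
    obtain ⟨n, rfl⟩ := hdd'.exists_nat_pow_eq
    clear hd' hdd'
    induction n with
    | zero => simp
    | succ n ih =>
      rw [pow_succ', Equiv.Perm.mul_apply]
      simp only [mem_insert, mem_singleton] at ih ⊢
      rcases ih with h | h | h <;> rw [h]
      · tauto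
      · tauto
      · rw [h3]; tauto
  rw [card_univ, dart_card_eq_twice_card_edges, card_univ] at h1
  rw [Nat.card_eq_fintype_card (α := R.Face)]
  rw [← coe_edgeFinset, Nat.card_coe_set_eq, Set.ncard_coe_finset] at hE ⊢
  omega

end Planar

end SimpleGraph

namespace SimpleGraph

/-! ### Rotation systems from cyclic lists of neighbors -/

section Lists

variable {t : ℕ}

/-- The graph in which the neighbors of each vertex are listed. -/
def ofLists (l : Fin t → List (Fin t)) (hs : ∀ u, ∀ v ∈ l u, u ∈ l v) (hl : ∀ u, u ∉ l u) :
    SimpleGraph (Fin t) where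
  Adj u v := v ∈ l u
  symm := ⟨fun u v h => hs u v h⟩
  loopless := ⟨hl⟩

lemma mem_neighborFinset_ofLists {l : Fin t → List (Fin t)} {hs : ∀ u, ∀ v ∈ l u, u ∈ l v}
    {hl : ∀ u, u ∉ l u} {u v : Fin t} [Fintype ((ofLists l hs hl).neighborSet u)] :
    v ∈ (ofLists l hs hl).neighborFinset u ↔ v ∈ l u :=
  mem_neighborFinset ..

lemma degree_ofLists {l : Fin t → List (Fin t)} {hs : ∀ u, ∀ v ∈ l u, u ∈ l v}
    {hl : ∀ u, u ∉ l u} (hn : ∀ u, (l u).Nodup) (u : Fin t)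
    [Fintype ((ofLists l hs hl).neighborSet u)] :
    (ofLists l hs hl).degree u = (l u).length := by
  rw [← List.toFinset_card_of_nodup (hn u), ← card_neighborFinset_eq_degree]
  congr 1
  ext v
  rw [mem_neighborFinset_ofLists, List.mem_toFinset]

/-- The permutation of darts that rotates every list of neighbors. -/
def listNext (l : Fin t → List (Fin t)) (hs : ∀ u, ∀ v ∈ l u, u ∈ l v) (hl : ∀ u, u ∉ l u) :
    Equiv.Perm (ofLists l hs hl).Dart where
  toFun d := ⟨(d.fst, (l d.fst).formPerm d.snd),
    (List.formPerm_mem_iff_mem (l := l d.fst)).2 d.adj⟩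
  invFun d := ⟨(d.fst, (l d.fst).formPerm⁻¹ d.snd), by
    refine (List.formPerm_mem_iff_mem (l := l d.fst)).1 ?_
    have h : d.snd ∈ l d.fst := d.adj
    simpa using h⟩
  left_inv d := by ext <;> simp
  right_inv d := by ext <;> simp

lemma listNext_pow_toProd (l : Fin t → List (Fin t)) (hs : ∀ u, ∀ v ∈ l u, u ∈ l v)
    (hl : ∀ u, u ∉ l u) (d : (ofLists l hs hl).Dart) (n : ℕ) :
    ((listNext l hs hl ^ n) d).toProd = (d.fst, ((l d.fst).formPerm ^ n) d.snd) := by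
  induction n with
  | zero => rfl
  | succ n ih =>
    rw [pow_succ', pow_succ', Equiv.Perm.mul_apply, Equiv.Perm.mul_apply]
    change (((listNext l hs hl ^ n) d).fst,
      (l ((listNext l hs hl ^ n) d).fst).formPerm ((listNext l hs hl ^ n) d).snd) = _
    rw [ih]

/-- The rotation system in which the neighbors of each vertex are listed in cyclic order. -/
def listRotation (l : Fin t → List (Fin t)) (hs : ∀ u, ∀ v ∈ l u, u ∈ l v) (hl : ∀ u, u ∉ l u)
    (hn : ∀ u, (l u).Nodup) : (ofLists l hs hl).RotationSystem where
  next := listNext l hs hl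
  next_fst d := rfl
  sameCycle_next := by
    rintro ⟨⟨u, v⟩, h⟩ ⟨⟨u', w⟩, h'⟩ huu'
    obtain rfl : u = u' := huu'
    obtain ⟨n, hn⟩ := ((hn u).isCycleOn_formPerm.2 h h').exists_nat_pow_eq
    refine ⟨n, Dart.ext _ _ ?_⟩
    rw [zpow_natCast, listNext_pow_toProd]
    exact congrArg (Prod.mk u) hn

end Lists

/-- There is a planar `K`-free graph with `n` vertices and `e` edges. -/
def HasPlanarFree {U : Type*} (K : SimpleGraph U) (n e : ℕ) : Prop :=
  ∃ G : SimpleGraph (Fin n), G.IsPlanar ∧ K.Free G ∧ Nat.card G.edgeSet = e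

/-! ### Disjoint copies and isolated vertices -/

section HasPlanarFree

variable {U : Type*} {K : SimpleGraph U} {n m e f : ℕ}

lemma HasPlanarFree.le_planarTuranNumber (h : HasPlanarFree K n e) :
    e ≤ planarTuranNumber n K := by
  classical
  obtain ⟨G, hG, hK, rfl⟩ := h
  rw [← coe_edgeFinset, Nat.card_coe_set_eq, Set.ncard_coe_finset]
  unfold planarTuranNumber
  have hmem : G ∈ ({G : SimpleGraph (Fin n) | G.IsPlanar ∧ K.Free G} : Finset _) :=
    mem_filter.2 ⟨mem_univ G, hG, hK⟩
  convert Finset.le_sup (f := fun G : SimpleGraph (Fin n) => #G.edgeFinset) hmem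

lemma HasPlanarFree.add (hK : K.Connected) (h1 : HasPlanarFree K n e) (h2 : HasPlanarFree K m f) :
    HasPlanarFree K (n + m) (e + f) := by
  obtain ⟨G, hG, hKG, rfl⟩ := h1
  obtain ⟨H, hH, hKH, rfl⟩ := h2
  let i : G ⊕g H ≃g (G ⊕g H).map finSumFinEquiv.toEmbedding := Iso.map finSumFinEquiv _
  refine ⟨(G ⊕g H).map finSumFinEquiv.toEmbedding, (hG.sum hH).of_iso i,
    (Free.sum hK hKG hKH).congr_right i.symm, ?_⟩
  rw [← Nat.card_congr i.mapEdgeSet, Nat.card_congr edgeSetSumEquiv, Nat.card_sum]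

lemma hasPlanarFree_zero (hK : K ≠ ⊥) (n : ℕ) : HasPlanarFree K n 0 :=
  ⟨⊥, isPlanar_bot, free_bot hK, by simp⟩

lemma HasPlanarFree.mul (hK : K.Connected) (hK' : K ≠ ⊥) (h : HasPlanarFree K n e) (q r : ℕ) :
    HasPlanarFree K (q * n + r) (q * e) := by
  induction q with
  | zero => simpa using hasPlanarFree_zero hK' r
  | succ q ih =>
    have := h.add hK ih
    convert this using 1 <;> ring

lemma HasPlanarFree.mul_div_le (hK : K.Connected) (hK' : K ≠ ⊥) (h : HasPlanarFree K m e) (n : ℕ) :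
    n / m * e ≤ planarTuranNumber n K := by
  have h1 := h.mul hK hK' (n / m) (n % m)
  rw [Nat.div_add_mod'] at h1
  exact h1.le_planarTuranNumber

lemma free_of_card_lt {t : ℕ} [Finite U] (G : SimpleGraph (Fin t)) (h : t < Nat.card U) :
    K.Free G := by
  rintro ⟨f⟩
  have := Nat.card_le_card_of_injective f f.injective
  rw [Nat.card_fin] at this
  omega

end HasPlanarFree

/-- A triangulation of the sphere, given by the cyclic orders of the neighbors of its vertices. -/
structure IsTriangulation {t : ℕ} (l : Fin t → List (Fin t)) : Prop where
  symm : ∀ u, ∀ v ∈ l u, u ∈ l v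
  irrefl : ∀ u, u ∉ l u
  nodup : ∀ u, (l u).Nodup
  triangle : ∀ u, ∀ v ∈ l u, (l ((l v).formPerm u)).formPerm v = u ∧
    (l u).formPerm ((l v).formPerm u) = v
  connected : ∀ u, u.val ≠ 0 → ∃ v ∈ l u, v < u
  sum_length : ∑ u, (l u).length + 12 = 6 * t

namespace IsTriangulation

variable {t : ℕ} {l : Fin t → List (Fin t)}

lemma card_edgeSet (hl : IsTriangulation l) :
    2 * Nat.card (ofLists l hl.symm hl.irrefl).edgeSet = ∑ u, (l u).length := by
  classical
  rw [← coe_edgeFinset, Nat.card_coe_set_eq, Set.ncard_coe_finset,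
    ← sum_degrees_eq_twice_card_edges]
  exact sum_congr rfl fun u _ => degree_ofLists hl.nodup u

/-- The field `triangle` says that tracing a face from the dart u → v returns after three steps, and
`connected` descends from any vertex to 0 through smaller neighbors. -/
lemma isPlanar (ht : 0 < t) (hl : IsTriangulation l) :
    (ofLists l hl.symm hl.irrefl).IsPlanar := by
  refine (listRotation l hl.symm hl.irrefl hl.nodup).isPlanar_of_triangulation ?_ ?_ ?_
  · rintro ⟨⟨u, v⟩, h⟩
    obtain ⟨h1, h2⟩ := hl.triangle u v h
    ext
    · exact congrArg Fin.val h1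
    · change Fin.val ((l ((l ((l v).formPerm u)).formPerm v)).formPerm ((l v).formPerm u)) = v
      rw [h1, h2]
  · have key : ∀ n, ∀ u : Fin t, u.val = n →
        (ofLists l hl.symm hl.irrefl).Reachable u ⟨0, ht⟩ := by
      intro n
      induction n using Nat.strong_induction_on with
      | _ n ih =>
        rintro u rfl
        by_cases hu : u.val = 0
        · have : u = ⟨0, ht⟩ := Fin.ext hu
          rw [this]
        · obtain ⟨v, hv, hlt⟩ := hl.connected u hu
          have hadj : (ofLists l hl.symm hl.irrefl).Adj u v := hv
          exact hadj.reachable.trans (ih v.val hlt v rfl)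
    have : Nonempty (Fin t) := ⟨⟨0, ht⟩⟩
    exact ⟨fun u v => (key _ u rfl).trans (key _ v rfl).symm⟩
  · have h1 := hl.card_edgeSet
    have h2 := hl.sum_length
    rw [Nat.card_fin]
    omega

lemma hasPlanarFree {U : Type*} {K : SimpleGraph U} (ht : 0 < t) (hl : IsTriangulation l)
    (hK : K.Free (ofLists l hl.symm hl.irrefl)) : HasPlanarFree K t (3 * t - 6) := by
  refine ⟨_, hl.isPlanar ht, hK, ?_⟩
  have h1 := hl.card_edgeSet
  have h2 := hl.sum_length
  omega

end IsTriangulation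

lemma isTriangulation_bipyramid_three : IsTriangulation (t := 5)
    ![[1, 2, 3], [0, 3, 4, 2], [0, 1, 4, 3], [0, 2, 4, 1], [3, 2, 1]] := by
  constructor <;> decide

lemma isTriangulation_bipyramid_four : IsTriangulation (t := 6)
    ![[1, 2, 3, 4], [0, 4, 5, 2], [0, 1, 5, 3], [0, 2, 5, 4], [0, 3, 5, 1], [4, 3, 2, 1]] := by
  constructor <;> decide

lemma isTriangulation_bipyramid_five : IsTriangulation (t := 7)
    ![[1, 2, 3, 4, 5], [0, 5, 6, 2], [0, 1, 6, 3], [0, 2, 6, 4], [0, 3, 6, 5], [0, 4, 6, 1],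
      [5, 4, 3, 2, 1]] := by
  constructor <;> decide

lemma isTriangulation_bipyramid_six : IsTriangulation (t := 8)
    ![[1, 2, 3, 4, 5, 6], [0, 6, 7, 2], [0, 1, 7, 3], [0, 2, 7, 4], [0, 3, 7, 5], [0, 4, 7, 6],
      [0, 5, 7, 1], [6, 5, 4, 3, 2, 1]] := by
  constructor <;> decide

lemma isTriangulation_icosahedron : IsTriangulation (t := 12)
    ![[1, 2, 3, 4, 5], [0, 5, 10, 6, 2], [0, 1, 6, 7, 3], [0, 2, 7, 8, 4], [0, 3, 8, 9, 5],
      [0, 4, 9, 10, 1], [1, 10, 11, 7, 2], [2, 6, 11, 8, 3], [3, 7, 11, 9, 4], [4, 8, 11, 10, 5],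
      [5, 9, 11, 6, 1], [6, 10, 9, 8, 7]] := by
  constructor <;> decide

/-! ### Free triangulations: bipyramids and the icosahedron -/

section QuasiDoubleStar

variable {h k : ℕ}

lemma quasiDoubleStar_adj_zero_one :
    (quasiDoubleStar h k).Adj (.inl 0) (.inl 1) := by
  simp [quasiDoubleStar]

lemma quasiDoubleStar_adj_one_two :
    (quasiDoubleStar h k).Adj (.inl 1) (.inl 2) := by
  simp [quasiDoubleStar]

lemma quasiDoubleStar_adj_zero_leaf (i : Fin h) :
    (quasiDoubleStar h k).Adj (.inl 0) (.inr (.inl i)) := by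
  simp [quasiDoubleStar]

lemma quasiDoubleStar_adj_two_leaf (j : Fin k) :
    (quasiDoubleStar h k).Adj (.inl 2) (.inr (.inr j)) := by
  simp [quasiDoubleStar]

lemma quasiDoubleStar_ne_bot : quasiDoubleStar h k ≠ ⊥ := fun hb => by
  have h1 := quasiDoubleStar_adj_zero_one (h := h) (k := k)
  rw [hb] at h1
  exact h1

lemma quasiDoubleStar_connected : (quasiDoubleStar h k).Connected := by
  have h0 := (quasiDoubleStar_adj_zero_one (h := h) (k := k)).symm.reachable
  have h2 := (quasiDoubleStar_adj_one_two (h := h) (k := k)).reachable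
  have key : ∀ p, (quasiDoubleStar h k).Reachable (.inl 1) p := by
    rintro (i | i | j)
    · fin_cases i
      exacts [h0, .refl _, h2]
    · exact h0.trans (quasiDoubleStar_adj_zero_leaf i).reachable
    · exact h2.trans (quasiDoubleStar_adj_two_leaf j).reachable
  have : Nonempty (Fin 3 ⊕ (Fin h ⊕ Fin k)) := ⟨.inl 1⟩
  exact ⟨fun p q => (key p).symm.trans (key q)⟩

lemma card_quasiDoubleStar : Nat.card (Fin 3 ⊕ (Fin h ⊕ Fin k)) = h + k + 3 := by
  simp
  omega

lemma quasiDoubleStar_free_of_degree_le {V : Type*} [Fintype V] (G : SimpleGraph V)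
    [DecidableRel G.Adj] (hG : ∀ v, G.degree v ≤ k) : (quasiDoubleStar h k).Free G := by
  rintro ⟨f⟩
  let g : Option (Fin k) → G.neighborFinset (f (.inl 2)) := fun o => match o with
    | none => ⟨f (.inl 1), (mem_neighborFinset ..).2 (f.toHom.map_adj
        quasiDoubleStar_adj_one_two.symm)⟩
    | some j => ⟨f (.inr (.inr j)), (mem_neighborFinset ..).2 (f.toHom.map_adj
        (quasiDoubleStar_adj_two_leaf j))⟩
  have hg : Function.Injective g := by
    rintro (_ | i) (_ | j) hij
    · rfl
    · exact absurd (f.injective (congrArg Subtype.val hij)) (by simp)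
    · exact absurd (f.injective (congrArg Subtype.val hij)) (by simp)
    · have := f.injective (congrArg Subtype.val hij)
      simpa using this
  have h1 := Fintype.card_le_of_injective g hg
  rw [Fintype.card_option, Fintype.card_fin, Fintype.card_coe, card_neighborFinset_eq_degree] at h1
  have := hG (f (.inl 2))
  omega

lemma hasPlanarFree_quasiDoubleStar_add_two (h3 : 3 ≤ h + k) (h6 : h + k ≤ 6) :
    HasPlanarFree (quasiDoubleStar h k) (h + k + 2) (3 * (h + k)) := by
  -- The tree has h + k + 3 vertices, one too many.
  have hfree : ∀ G : SimpleGraph (Fin (h + k + 2)), (quasiDoubleStar h k).Free G := fun G =>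
    free_of_card_lt G (by rw [card_quasiDoubleStar]; omega)
  generalize hs : h + k = s at *
  interval_cases s
  · exact isTriangulation_bipyramid_three.hasPlanarFree (by omega) (hfree _)
  · exact isTriangulation_bipyramid_four.hasPlanarFree (by omega) (hfree _)
  · exact isTriangulation_bipyramid_five.hasPlanarFree (by omega) (hfree _)
  · exact isTriangulation_bipyramid_six.hasPlanarFree (by omega) (hfree _)

lemma hasPlanarFree_quasiDoubleStar_five : HasPlanarFree (quasiDoubleStar h 5) 12 30 := by
  classical
  refine isTriangulation_icosahedron.hasPlanarFree (by omega)
    (quasiDoubleStar_free_of_degree_le _ fun v => ?_)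
  rw [degree_ofLists isTriangulation_icosahedron.nodup]
  revert v
  decide

end QuasiDoubleStar

end SimpleGraph

open SimpleGraph in
theorem theorem1p2 :
    -- part (1): 3 ≤ h + k ≤ 5
    (∀ h k : ℕ, 1 ≤ h → h ≤ 2 → 2 ≤ k → k ≤ 5 → 3 ≤ h + k → h + k ≤ 5 → ∀ n : ℕ,
      (SimpleGraph.planarTuranNumber n (SimpleGraph.quasiDoubleStar h k) : ℝ)
          ≤ 3 * ((h : ℝ) + k) / ((h : ℝ) + k + 2) * n ∧
      ((h + k + 2) ∣ n →
        (SimpleGraph.planarTuranNumber n (SimpleGraph.quasiDoubleStar h k) : ℝ)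
          = 3 * ((h : ℝ) + k) / ((h : ℝ) + k + 2) * n)) ∧
    -- part (2): h + k = 6
    (∀ h k : ℕ, 1 ≤ h → h ≤ 2 → 2 ≤ k → k ≤ 5 → h + k = 6 → ∀ n : ℕ,
      (SimpleGraph.planarTuranNumber n (SimpleGraph.quasiDoubleStar h k) : ℝ) ≤ 5 / 2 * n ∧
      (8 ∣ n →
        9 / 4 * (n : ℝ) ≤ SimpleGraph.planarTuranNumber n (SimpleGraph.quasiDoubleStar h k)) ∧
      9 / 4 * ((n : ℝ) - 7) ≤ SimpleGraph.planarTuranNumber n (SimpleGraph.quasiDoubleStar h k) ∧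
      (h = 1 → k = 5 → 12 ∣ n →
        (SimpleGraph.planarTuranNumber n (SimpleGraph.quasiDoubleStar h k) : ℝ) = 5 / 2 * n)) ∧
    -- part (3): (h, k) = (2, 5)
    (∀ n : ℕ,
      (SimpleGraph.planarTuranNumber n (SimpleGraph.quasiDoubleStar 2 5) : ℝ) ≤ 17 / 6 * n ∧
      (12 ∣ n →
        5 / 2 * (n : ℝ) ≤ SimpleGraph.planarTuranNumber n (SimpleGraph.quasiDoubleStar 2 5)) ∧
      5 / 2 * ((n : ℝ) - 11)
        ≤ SimpleGraph.planarTuranNumber n (SimpleGraph.quasiDoubleStar 2 5)) := by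
  refine ⟨fun h k h1 h2 k2 k5 h3 h5 n => ?_, fun h k h1 h2 k2 k5 h6 n => ?_, fun n => ?_⟩
  · have hpos : (0 : ℝ) < h + k + 2 := by positivity
    have hle : planarTuranNumber n (quasiDoubleStar h k) * (h + k + 2) ≤ 3 * (h + k) * n := by
      -- The ratios 18/5, 4 and 30/7 are twice 3(h + k)/(h + k + 2).
      obtain hs | hs | hs : h + k = 3 ∨ h + k = 4 ∨ h + k = 5 := by omega
      · have := planarTuranNumber_le n fun H A hA (hc : H.IsCritical A h k 18 5) =>
          hc.false_of_add_eq_three hA (by omega) hs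
        rw [hs]
        linarith
      · have := planarTuranNumber_le n fun H A hA (hc : H.IsCritical A h k 4 1) =>
          hc.false_of_add_eq_four hA h1 h2 hs
        rw [hs]
        linarith
      · have := planarTuranNumber_le n fun H A hA (hc : H.IsCritical A h k 30 7) =>
          hc.false_of_add_eq_five hA h1 h2 hs
        rw [hs]
        linarith
    have hle' : (planarTuranNumber n (quasiDoubleStar h k) : ℝ) ≤
        3 * ((h : ℝ) + k) / ((h : ℝ) + k + 2) * n := by
      rw [div_mul_eq_mul_div, le_div_iff₀ hpos]
      exact_mod_cast hle
    refine ⟨hle', fun hdvd => le_antisymm hle' ?_⟩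
    have hge := (hasPlanarFree_quasiDoubleStar_add_two h3 (by omega)).mul_div_le
      quasiDoubleStar_connected quasiDoubleStar_ne_bot n
    obtain ⟨q, rfl⟩ := hdvd
    rw [Nat.mul_div_cancel_left _ (by omega)] at hge
    rw [div_mul_eq_mul_div, div_le_iff₀ hpos]
    have := Nat.mul_le_mul_right (h + k + 2) hge
    have h' : ((q * (3 * (h + k)) * (h + k + 2) : ℕ) : ℝ) ≤
      (planarTuranNumber ((h + k + 2) * q) (quasiDoubleStar h k) * (h + k + 2) : ℕ) :=
      Nat.cast_le.2 this
    push_cast at h' ⊢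
    linarith
  · have hle := planarTuranNumber_le n fun H A hA (hc : H.IsCritical A h k 5 1) =>
      hc.false_of_add_eq_six hA h1 h2 h6
    have hge := (hasPlanarFree_quasiDoubleStar_add_two (h := h) (k := k) (by omega)
      (by omega)).mul_div_le quasiDoubleStar_connected quasiDoubleStar_ne_bot n
    rw [h6] at hge
    have hle' : (2 * 1 * planarTuranNumber n (quasiDoubleStar h k) : ℝ) ≤ 5 * n := by
      exact_mod_cast hle
    refine ⟨by linarith, fun hdvd => ?_, ?_, ?_⟩
    · have : 9 * n ≤ 4 * planarTuranNumber n (quasiDoubleStar h k) := by omega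
      have : (9 * n : ℝ) ≤ 4 * planarTuranNumber n (quasiDoubleStar h k) := by exact_mod_cast this
      linarith
    -- At most seven vertices are left over by copies with 8 vertices and 18 edges.
    · have : 9 * n ≤ 4 * planarTuranNumber n (quasiDoubleStar h k) + 63 := by omega
      have : (9 * n : ℝ) ≤ 4 * planarTuranNumber n (quasiDoubleStar h k) + 63 := by
        exact_mod_cast this
      linarith
    · rintro rfl rfl hdvd
      have hge' := (hasPlanarFree_quasiDoubleStar_five (h := 1)).mul_div_le
        quasiDoubleStar_connected quasiDoubleStar_ne_bot n
      have : 5 * n ≤ 2 * planarTuranNumber n (quasiDoubleStar 1 5) := by omega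
      have : (5 * n : ℝ) ≤ 2 * planarTuranNumber n (quasiDoubleStar 1 5) := by exact_mod_cast this
      linarith
  · have hle := planarTuranNumber_le n fun H A hA (hc : H.IsCritical A 2 5 17 3) =>
      hc.false_of_two_five hA
    have hge := (hasPlanarFree_quasiDoubleStar_five (h := 2)).mul_div_le
      quasiDoubleStar_connected quasiDoubleStar_ne_bot n
    have hle' : (2 * 3 * planarTuranNumber n (quasiDoubleStar 2 5) : ℝ) ≤ 17 * n := by
      exact_mod_cast hle
    refine ⟨by linarith, fun hdvd => ?_, ?_⟩
    · have : 5 * n ≤ 2 * planarTuranNumber n (quasiDoubleStar 2 5) := by omega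
      have : (5 * n : ℝ) ≤ 2 * planarTuranNumber n (quasiDoubleStar 2 5) := by exact_mod_cast this
      linarith
    · have : 5 * n ≤ 2 * planarTuranNumber n (quasiDoubleStar 2 5) + 55 := by omega
      have : (5 * n : ℝ) ≤ 2 * planarTuranNumber n (quasiDoubleStar 2 5) + 55 := by
        exact_mod_cast this
      linarith
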